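/- Let $k$ be a field of characteristic different from $2$ and $3$. A unital Jordan algebra over $k$ is a $k$-vector space $J$ with a commutative bilinear product with unit $1$ such that $(a^2b)a=a^2(ba)$ for all $a,b\in J$; morphisms are the unital algebra homomorphisms. An $A_1$-graded Lie algebra over $k$ is a Lie algebra $L$ over $k$ together with elements $h,e,f\in L$ satisfying $[e,f]=h$, $[h,e]=2e$, $[h,f]=-2f$, such that $L=L_{-1}\oplus L_0\oplus L_1$, where $L_i=\{x\in L:[h,x]=2ix\}$, and $L_0=[L_{-1},L_1]$ (the span of the brackets); morphisms are the Lie algebra homomorphisms that send $h,e,f$ to $h,e,f$ respectively. No dimension is assumed finite, and the zero algebras are allowed. Let $H_2(L)=H_2(L,k)$ denote the second Chevalley–Eilenberg homology of the underlying Lie algebra $L$ (the homology of $\wedge^3L\to\wedge^2L\to L$) and $H^2(L,M)$ the second Chevalley–Eilenberg cohomology with coefficients in an $L$-module $M$ (ordinary, not graded, homology and cohomology). **Theorem C.** For an $A_1$-graded Lie algebra $L$ over $k$ the following conditions are equivalent: (i) $H_2(L)=0$; (ii) $H^2(L,M)=0$ for every trivial $L$-module $M$. The category of unital Jordan algebras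 over $k$ is equivalent to the full subcategory of the category of $A_1$-graded Lie algebras over $k$ consisting of those $L$ that satisfy these equivalent conditions. More precisely, there is such an equivalence for which the functor from Lie algebras to Jordan algebras is, up to natural isomorphism, $L\mapsto L_1$ with product $a\cdot b=[[a,f],b]$ and unit $\tfrac12e$, a morphism being sent to its restriction to $L_1$. -/

import Mathlib

open CategoryTheory

universe u v w

/-! ### Unital Jordan algebras -/

/-- A unital (linear) Jordan algebra over `k`: a commutative, not necessarily associative,
unital `k`-algebra satisfying `(a * b) * a² = a * (b * a²)`, which in the commutative case is
`(a² * b) * a = a² * (b * a)`. -/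
structure UnitalJordanAlg (k : Type u) [CommRing k] where
  carrier : Type v
  [ring : NonAssocCommRing carrier]
  [module : Module k carrier]
  [isScalarTower : IsScalarTower k carrier carrier]
  [smulCommClass : SMulCommClass k carrier carrier]
  [jordan : IsCommJordan carrier]

namespace UnitalJordanAlg

instance (k : Type u) [CommRing k] : CoeSort (UnitalJordanAlg.{u, v} k) (Type v) := ⟨carrier⟩

attribute [instance] ring module isScalarTower smulCommClass jordan

variable {k : Type u} [CommRing k]

/-- Homomorphisms of unital Jordan algebras: linear maps preserving product and unit. -/
@[ext]
structure Hom (A B : UnitalJordanAlg.{u, v} k) where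
  toLin : A →ₗ[k] B
  map_mul : ∀ a b : A, toLin (a * b) = toLin a * toLin b
  map_one : toLin 1 = 1

instance : Category (UnitalJordanAlg.{u, v} k) where
  Hom A B := Hom A B
  id A := ⟨LinearMap.id, fun _ _ => rfl, rfl⟩
  comp f g := ⟨g.toLin ∘ₗ f.toLin,
    fun a b => by simp [f.map_mul, g.map_mul], by simp [f.map_one, g.map_one]⟩

end UnitalJordanAlg

/-! ### A₁-graded Lie algebras -/

section Graded

variable (k : Type u) [CommRing k] {L : Type v} [LieRing L] [LieAlgebra k L]

/-- The submodule `L_i = {x ∈ L : [h, x] = 2 i x}`. -/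
def lieGradedPiece (h : L) (i : ℤ) : Submodule k L where
  carrier := {x | ⁅h, x⁆ = (2 * i) • x}
  add_mem' {x y} hx hy := by
    simp only [Set.mem_ofPred_eq] at hx hy ⊢
    rw [lie_add, hx, hy, smul_add]
  zero_mem' := by simp
  smul_mem' c x hx := by
    simp only [Set.mem_ofPred_eq] at hx ⊢
    rw [lie_smul, hx, smul_comm]

end Graded

/-- An A₁-graded Lie algebra over `k`: a Lie algebra `L` with an ordered triple `⟨h, e, f⟩` such
that `[e, f] = h`, `[h, e] = 2 e`, `[h, f] = -2 f`, `L = L₋₁ ⊕ L₀ ⊕ L₁` where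
`L_i = {x : [h, x] = 2 i x}`, and `L₀ = [L₋₁, L₁]`. (The triple may be zero, when `L = 0`.) -/
structure A1GradedLieAlg (k : Type u) [CommRing k] where
  carrier : Type v
  [lieRing : LieRing carrier]
  [lieAlgebra : LieAlgebra k carrier]
  h : carrier
  e : carrier
  f : carrier
  lie_e_f : ⁅e, f⁆ = h
  lie_h_e : ⁅h, e⁆ = (2 : ℤ) • e
  lie_h_f : ⁅h, f⁆ = (-2 : ℤ) • f
  isInternal : DirectSum.IsInternal fun i : SignType => lieGradedPiece k h (i : ℤ)
  zero_eq_lie : lieGradedPiece k h 0 =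
    Submodule.span k {z | ∃ x ∈ lieGradedPiece k h (-1), ∃ y ∈ lieGradedPiece k h 1, ⁅x, y⁆ = z}

namespace A1GradedLieAlg

instance (k : Type u) [CommRing k] : CoeSort (A1GradedLieAlg.{u, v} k) (Type v) := ⟨carrier⟩

attribute [instance] lieRing lieAlgebra

variable {k : Type u} [CommRing k]

/-- Morphisms of A₁-graded Lie algebras: Lie algebra homomorphisms preserving the triple. -/
@[ext]
structure Hom (L K : A1GradedLieAlg.{u, v} k) where
  toLieHom : L →ₗ⁅k⁆ K
  map_h : toLieHom L.h = K.h
  map_e : toLieHom L.e = K.e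
  map_f : toLieHom L.f = K.f

instance : Category (A1GradedLieAlg.{u, v} k) where
  Hom L K := Hom L K
  id L := ⟨LieHom.id, rfl, rfl, rfl⟩
  comp φ ψ := ⟨ψ.toLieHom.comp φ.toLieHom,
    by simp [φ.map_h, ψ.map_h], by simp [φ.map_e, ψ.map_e], by simp [φ.map_f, ψ.map_f]⟩

/-- The component `L₁`. -/
def one (L : A1GradedLieAlg.{u, v} k) : Submodule k L := lieGradedPiece k L.h 1

end A1GradedLieAlg

/-! ### The second homology and cohomology of a Lie algebra -/

/-- The homology `ker g / (ker g ∩ im f)` of `A → B → C` at `B`. -/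
abbrev HomologyAt {R A B C : Type*} [CommRing R] [AddCommMonoid A] [Module R A]
    [AddCommGroup B] [Module R B] [AddCommMonoid C] [Module R C]
    (f : A →ₗ[R] B) (g : B →ₗ[R] C) : Type _ :=
  LinearMap.ker g ⧸ (LinearMap.range f).submoduleOf (LinearMap.ker g)

section Homology

variable (k : Type u) [CommRing k] (L : Type v) [LieRing L] [LieAlgebra k L]

lemma exteriorPower_two_add_left (x x' y : L) : exteriorPower.ιMulti k 2 ![x + x', y] =
    exteriorPower.ιMulti k 2 ![x, y] + exteriorPower.ιMulti k 2 ![x', y] :=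
  (exteriorPower.ιMulti k 2).map_vecCons_add ![y] x x'

lemma exteriorPower_two_smul_left (c : k) (x y : L) : exteriorPower.ιMulti k 2 ![c • x, y] =
    c • exteriorPower.ιMulti k 2 ![x, y] :=
  (exteriorPower.ιMulti k 2).map_vecCons_smul ![y] c x

lemma exteriorPower_two_self (x : L) : exteriorPower.ιMulti k 2 ![x, x] = 0 :=
  (exteriorPower.ιMulti k 2).map_eq_zero_of_eq (i := 0) (j := 1) _ rfl (by decide)

lemma exteriorPower_two_swap (x y : L) : exteriorPower.ιMulti k 2 ![x, y] =
    - exteriorPower.ιMulti k 2 ![y, x] := by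
  rw [← AlternatingMap.map_swap (exteriorPower.ιMulti k 2) ![y, x] (i := 0) (j := 1) (by decide)]
  congr 1
  ext i
  fin_cases i <;> rfl

lemma exteriorPower_two_add_right (x y y' : L) : exteriorPower.ιMulti k 2 ![x, y + y'] =
    exteriorPower.ιMulti k 2 ![x, y] + exteriorPower.ιMulti k 2 ![x, y'] := by
  rw [exteriorPower_two_swap, exteriorPower_two_add_left, neg_add,
    ← exteriorPower_two_swap, ← exteriorPower_two_swap]

lemma exteriorPower_two_smul_right (c : k) (x y : L) : exteriorPower.ιMulti k 2 ![x, c • y] =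
    c • exteriorPower.ιMulti k 2 ![x, y] := by
  rw [exteriorPower_two_swap, exteriorPower_two_smul_left, exteriorPower_two_swap k L x y]
  exact (smul_neg c _).symm

/-- The Chevalley–Eilenberg boundary `⋀² L → L`, `x ∧ y ↦ -[x, y]`. -/
noncomputable def lieBoundary₁ : ⋀[k]^2 L →ₗ[k] L :=
  exteriorPower.alternatingMapLinearEquiv
    { toFun := fun m => -⁅m 0, m 1⁆
      map_update_add' := by
        intro inst m i x y
        obtain rfl : inst = instDecidableEqFin _ := Subsingleton.elim _ _
        fin_cases i <;> simp <;> abel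
      map_update_smul' := by
        intro inst m i c x
        obtain rfl : inst = instDecidableEqFin _ := Subsingleton.elim _ _
        fin_cases i <;> simp [-lie_skew, -neg_lie, -lie_neg, lie_smul, smul_lie]
      map_eq_zero_of_eq' := by
        intro m i j hm hij
        fin_cases i <;> fin_cases j <;> simp_all }

/-- The Chevalley–Eilenberg boundary `⋀³ L → ⋀² L`,
`x ∧ y ∧ z ↦ -[x, y] ∧ z + [x, z] ∧ y - [y, z] ∧ x`. -/
noncomputable def lieBoundary₂ : ⋀[k]^3 L →ₗ[k] ⋀[k]^2 L :=
  exteriorPower.alternatingMapLinearEquiv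
    { toFun := fun m => - exteriorPower.ιMulti k 2 ![⁅m 0, m 1⁆, m 2]
        + exteriorPower.ιMulti k 2 ![⁅m 0, m 2⁆, m 1]
        - exteriorPower.ιMulti k 2 ![⁅m 1, m 2⁆, m 0]
      map_update_add' := by
        intro inst m i x y
        obtain rfl : inst = instDecidableEqFin _ := Subsingleton.elim _ _
        fin_cases i <;> simp [exteriorPower_two_add_left, exteriorPower_two_add_right] <;> abel
      map_update_smul' := by
        intro inst m i c x
        obtain rfl : inst = instDecidableEqFin _ := Subsingleton.elim _ _
        fin_cases i <;> simp [exteriorPower_two_smul_left, exteriorPower_two_smul_right,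
          smul_sub, smul_add]
      map_eq_zero_of_eq' := by
        have h0 : ∀ x : L, exteriorPower.ιMulti k 2 ![0, x] = 0 := fun x => by
          simpa using exteriorPower_two_smul_left k L 0 0 x
        have hn : ∀ a b x : L, exteriorPower.ιMulti k 2 ![⁅a, b⁆, x] =
            - exteriorPower.ιMulti k 2 ![⁅b, a⁆, x] := fun a b x => by
          rw [← lie_skew a b, ← neg_one_smul k ⁅b, a⁆, exteriorPower_two_smul_left]
          exact neg_one_smul k (exteriorPower.ιMulti k 2 ![⁅b, a⁆, x])
        intro m i j hm hij
        have key : m 0 = m 1 ∨ m 0 = m 2 ∨ m 1 = m 2 := by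
          fin_cases i <;> fin_cases j <;> simp_all
        rcases key with h | h | h
        · simp [h, h0]
        · rw [h, hn (m 1) (m 2)]; simp [h0]
        · simp [h, h0] }

/-- The second homology `H₂(L) = H₂(L, k)` of the Chevalley–Eilenberg complex
`⋀³ L → ⋀² L → L`. -/
abbrev LieH₂ : Type (max u v) :=
  HomologyAt (R := k) (B := ⋀[k]^2 L) (lieBoundary₂ k L) (lieBoundary₁ k L)

/-- The second cohomology `H²(L, M)`: alternating 2-cocycles modulo coboundaries. -/
abbrev LieCohomology₂ (M : Type w) [AddCommGroup M] [Module k M] [LieRingModule L M]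
    [LieModule k L M] : Type (max v w) :=
  HomologyAt (R := k) (B := LieModule.Cohomology.twoCochain k L M)
    (LieModule.Cohomology.d₁₂ k L M) (LieModule.Cohomology.d₂₃ k L M)

end Homology

/-- The A₁-graded Lie algebras `L` with `H₂(L) = 0` (homology of the underlying Lie algebra). -/
def HasTrivialH₂ (k : Type u) [CommRing k] : ObjectProperty (A1GradedLieAlg.{u, v} k) :=
  fun L => Subsingleton (LieH₂ k L)

/-- The A₁-graded Lie algebras `L` with `H²(L, M) = 0` for every trivial `L`-module `M`. The
universe `max v w` with arbitrary `w` allows modules of every size at least that of `L`. -/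
def HasTrivialCohomology₂ (k : Type u) [CommRing k] : ObjectProperty (A1GradedLieAlg.{u, v} k) :=
  fun L => ∀ (M : Type (max v w)) [AddCommGroup M] [Module k M] [LieRingModule L M]
    [LieModule k L M] [LieModule.IsTrivial L M], Subsingleton (LieCohomology₂ k L M)

/-- Up to natural isomorphism, the functor `F` takes `(L, ⟨h, e, f⟩)` to the Jordan algebra `L₁`
with product `a ∘ b = [[a, f], b]` and unit `½ e`, and a morphism to its restriction to `L₁`:
`ι L` is the identification of `F L` with `L₁`. -/
def IsJordanFunctor {k : Type u} [CommRing k] {P : ObjectProperty (A1GradedLieAlg.{u, v} k)}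
    (F : P.FullSubcategory ⥤ UnitalJordanAlg.{u, v} k) : Prop :=
  ∃ ι : ∀ L : P.FullSubcategory, F.obj L →ₗ[k] L.obj,
    (∀ L, Function.Injective (ι L)) ∧
    (∀ L, LinearMap.range (ι L) = L.obj.one) ∧
    (∀ L (a b : F.obj L), ι L (a * b) = ⁅⁅ι L a, L.obj.f⁆, ι L b⁆) ∧
    (∀ L, (2 : k) • ι L 1 = L.obj.e) ∧
    (∀ (L K : P.FullSubcategory) (φ : L ⟶ K) (a : F.obj L),
      ι K ((F.map φ).toLin a) = φ.hom.toLieHom (ι L a))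

/-! Write A(J) for `TitsAllisonGao k J`, that is sl₂ ⊗ J ⊕ {J, J}, where {J, J} is presented by
symbols and relations instead of being realized by derivations of J. Everything rests on its
universal property: a linear map E from J to a Lie algebra K and an element f of K satisfying the
four relations of `IsCoordinatization` extend to a homomorphism A(J) → K
(`IsCoordinatization.toLieHom`), which is unique because ½e ⊗ J and f generate A(J)
(`TitsAllisonGao.eq_on`).

This is used three times. In a central extension of A(J), brackets depend only on images, so weight
vectors for a lift of ½h satisfy the relations exactly; hence the extension splits
(`exists_section_of_central`) and H₂(A(J)) = 0. In an A₁-graded L, the inclusion of L₁ together with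
f gives `counit` : A(L₁) → L, which is surjective with central kernel, and injective if H₂(L) = 0.
Finally, a Jordan homomorphism L₁ → K₁ transports the coordinatization of K to L₁, and so extends to
L ≅ A(L₁) → K: the functor L ↦ L₁ is full. It is faithful because L₁ and f generate L, and
essentially surjective because A(J)₁ ≅ J.

The equivalence of the two vanishing conditions is a universal coefficient argument: ⋀²L modulo
boundaries carries the universal 2-cocycle with trivial coefficients, and H₂(L) is the kernel of the
bracket map on it. -/

lemma subsingleton_homologyAt_iff {R A B C : Type*} [CommRing R] [AddCommMonoid A] [Module R A]
    [AddCommGroup B] [Module R B] [AddCommMonoid C] [Module R C]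
    (f : A →ₗ[R] B) (g : B →ₗ[R] C) :
    Subsingleton (HomologyAt f g) ↔ LinearMap.ker g ≤ LinearMap.range f :=
  Submodule.Quotient.subsingleton_iff.trans Submodule.submoduleOf_eq_top

/-! ### The universal 2-cocycle with trivial coefficients -/

section SecondHomology

variable (k : Type u) [CommRing k] (L : Type v) [LieRing L] [LieAlgebra k L]

lemma lieBoundary₁_ιMulti (x y : L) :
    lieBoundary₁ k L (exteriorPower.ιMulti k 2 ![x, y]) = -⁅x, y⁆ := by
  simp [lieBoundary₁, exteriorPower.alternatingMapLinearEquiv_apply_ιMulti]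

lemma lieBoundary₂_ιMulti (m : Fin 3 → L) :
    lieBoundary₂ k L (exteriorPower.ιMulti k 3 m) =
      - exteriorPower.ιMulti k 2 ![⁅m 0, m 1⁆, m 2] + exteriorPower.ιMulti k 2 ![⁅m 0, m 2⁆, m 1]
        - exteriorPower.ιMulti k 2 ![⁅m 1, m 2⁆, m 0] := by
  simp [lieBoundary₂, exteriorPower.alternatingMapLinearEquiv_apply_ιMulti]

/-- The quotient of `⋀² L` by the boundaries: the target of the universal alternating 2-cocycle
with trivial coefficients. -/
def WedgeModBoundaries : Type (max u v) := ⋀[k]^2 L ⧸ LinearMap.range (lieBoundary₂ k L)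

namespace WedgeModBoundaries

noncomputable instance : AddCommGroup (WedgeModBoundaries k L) :=
  inferInstanceAs (AddCommGroup (⋀[k]^2 L ⧸ LinearMap.range (lieBoundary₂ k L)))

noncomputable instance : Module k (WedgeModBoundaries k L) :=
  inferInstanceAs (Module k (⋀[k]^2 L ⧸ LinearMap.range (lieBoundary₂ k L)))

/-- The projection from `⋀² L`. -/
noncomputable def proj : ⋀[k]^2 L →ₗ[k] WedgeModBoundaries k L :=
  (LinearMap.range (lieBoundary₂ k L)).mkQ

lemma proj_surjective : Function.Surjective (proj k L) := Submodule.mkQ_surjective _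

lemma ker_proj : LinearMap.ker (proj k L) = LinearMap.range (lieBoundary₂ k L) :=
  Submodule.ker_mkQ _

/-- The universal alternating 2-cocycle. -/
noncomputable def wedge : L →ₗ[k] L →ₗ[k] WedgeModBoundaries k L :=
  LinearMap.mk₂ k (fun x y => proj k L (exteriorPower.ιMulti k 2 ![x, y]))
    (fun x x' y => by rw [exteriorPower_two_add_left, map_add])
    (fun c x y => by rw [exteriorPower_two_smul_left, map_smul])
    (fun x y y' => by rw [exteriorPower_two_add_right, map_add])
    (fun c x y => by rw [exteriorPower_two_smul_right, map_smul])

lemma wedge_apply (x y : L) :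
    wedge k L x y = proj k L (exteriorPower.ιMulti k 2 ![x, y]) := rfl

lemma wedge_self (x : L) : wedge k L x x = 0 := by
  rw [wedge_apply, exteriorPower_two_self, map_zero]

lemma wedge_cocycle (x y z : L) :
    - wedge k L ⁅x, y⁆ z + wedge k L ⁅x, z⁆ y - wedge k L ⁅y, z⁆ x = 0 := by
  have : proj k L (lieBoundary₂ k L (exteriorPower.ιMulti k 3 ![x, y, z])) = 0 :=
    (ker_proj k L).ge ⟨_, rfl⟩
  rw [lieBoundary₂_ιMulti] at this
  simpa [wedge_apply] using this

variable {k L}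

@[ext]
lemma hom_ext {M : Type*} [AddCommGroup M] [Module k M] {φ ψ : WedgeModBoundaries k L →ₗ[k] M}
    (h : ∀ x y, φ (wedge k L x y) = ψ (wedge k L x y)) : φ = ψ := by
  rw [← LinearMap.cancel_right (proj_surjective k L)]
  apply exteriorPower.linearMap_ext
  ext m
  have : m = ![m 0, m 1] := by ext i; fin_cases i <;> rfl
  rw [this]
  exact h _ _

/-- The linear map out of `⋀² L` modulo boundaries given by an alternating 2-cocycle. -/
noncomputable def lift {M : Type*} [AddCommGroup M] [Module k M] (c : L →ₗ[k] L →ₗ[k] M)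
    (halt : ∀ x, c x x = 0) (hc : ∀ x y z, - c ⁅x, y⁆ z + c ⁅x, z⁆ y - c ⁅y, z⁆ x = 0) :
    WedgeModBoundaries k L →ₗ[k] M :=
  (LinearMap.range (lieBoundary₂ k L)).liftQ
    (exteriorPower.alternatingMapLinearEquiv
      { toFun := fun m => c (m 0) (m 1)
        map_update_add' := by
          intro inst m i x y
          obtain rfl : inst = instDecidableEqFin _ := Subsingleton.elim _ _
          fin_cases i <;> simp
        map_update_smul' := by
          intro inst m i a x
          obtain rfl : inst = instDecidableEqFin _ := Subsingleton.elim _ _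
          fin_cases i <;> simp
        map_eq_zero_of_eq' := by
          intro m i j hm hij
          fin_cases i <;> fin_cases j <;> simp_all })
    (by
      rw [LinearMap.range_le_ker_iff]
      apply exteriorPower.linearMap_ext
      ext m
      have := hc (m 0) (m 1) (m 2)
      simpa [lieBoundary₂_ιMulti, exteriorPower.alternatingMapLinearEquiv_apply_ιMulti] using this)

lemma lift_wedge {M : Type*} [AddCommGroup M] [Module k M] (c : L →ₗ[k] L →ₗ[k] M)
    (halt : ∀ x, c x x = 0) (hc : ∀ x y z, - c ⁅x, y⁆ z + c ⁅x, z⁆ y - c ⁅y, z⁆ x = 0) (x y : L) :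
    lift c halt hc (wedge k L x y) = c x y := by
  refine (Submodule.liftQ_apply _ _ _).trans ?_
  rw [exteriorPower.alternatingMapLinearEquiv_apply_ιMulti]
  rfl

variable (k L)

/-- The Lie bracket as a map on `⋀² L` modulo boundaries. -/
noncomputable def bracket : WedgeModBoundaries k L →ₗ[k] L :=
  lift (LieModule.toEnd k L L : L →ₗ[k] Module.End k L) (fun x => by simp) (fun x y z => by
    simp only [LieHom.coe_toLinearMap, LieModule.toEnd_apply_apply]
    rw [lie_skew, ← lie_skew x z, neg_lie, lie_skew, sub_eq_add_neg, lie_skew, ← lie_jacobi x y z]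
    abel)

@[simp]
lemma bracket_wedge (x y : L) : bracket k L (wedge k L x y) = ⁅x, y⁆ := lift_wedge _ _ _ _ _

lemma bracket_comp_proj : bracket k L ∘ₗ proj k L = - lieBoundary₁ k L := by
  apply exteriorPower.linearMap_ext
  ext m
  have : m = ![m 0, m 1] := by ext i; fin_cases i <;> rfl
  rw [this]
  simp only [LinearMap.compAlternatingMap_apply, LinearMap.comp_apply, LinearMap.neg_apply,
    lieBoundary₁_ιMulti, neg_neg]
  exact bracket_wedge k L _ _

/-- Up to sign `bracket` is the map induced by the boundary ⋀²L → L, so its kernel is H₂(L). -/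
lemma subsingleton_lieH₂_iff :
    Subsingleton (LieH₂ k L) ↔ Function.Injective (bracket k L) := by
  have key : LinearMap.ker (lieBoundary₁ k L) = LinearMap.ker (bracket k L ∘ₗ proj k L) := by
    rw [bracket_comp_proj]; ext; simp
  rw [subsingleton_homologyAt_iff, key,
    ← LinearMap.ker_eq_bot, LinearMap.ker_comp, ← ker_proj, eq_bot_iff, ← Submodule.comap_bot]
  constructor
  · intro h x hx
    obtain ⟨t, rfl⟩ := proj_surjective k L x
    exact h hx
  · exact fun h => Submodule.comap_mono h

variable {k L}

/-- If the universal alternating 2-cocycle is a coboundary, then `H₂(L) = 0`. -/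
lemma subsingleton_lieH₂_of_coboundary (l : L →ₗ[k] WedgeModBoundaries k L)
    (hl : ∀ x y, l ⁅x, y⁆ = wedge k L x y) : Subsingleton (LieH₂ k L) := by
  rw [subsingleton_lieH₂_iff]
  -- A cochain bounding the universal cocycle is a left inverse of the bracket map.
  have : l ∘ₗ bracket k L = LinearMap.id := by ext x y; simp [hl]
  exact Function.LeftInverse.injective (g := l) (fun t => LinearMap.congr_fun this t)

end WedgeModBoundaries

end SecondHomology

/-! ### Universal coefficients over a field -/

section UniversalCoefficients

open WedgeModBoundaries LieModule.Cohomology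

variable {k : Type u} [Field k] {L : Type v} [LieRing L] [LieAlgebra k L]

/-- Over a field the injective bracket map has a linear left inverse; every cocycle factors through
the universal one, hence becomes a coboundary. -/
lemma exists_coboundary_of_subsingleton_lieH₂ (h : Subsingleton (LieH₂ k L)) {M : Type*}
    [AddCommGroup M] [Module k M] (c : L →ₗ[k] L →ₗ[k] M) (halt : ∀ x, c x x = 0)
    (hc : ∀ x y z, - c ⁅x, y⁆ z + c ⁅x, z⁆ y - c ⁅y, z⁆ x = 0) :
    ∃ l : L →ₗ[k] M, ∀ x y, l ⁅x, y⁆ = c x y := by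
  obtain ⟨s, hs⟩ := (bracket k L).exists_leftInverse_of_injective
    (LinearMap.ker_eq_bot.2 ((subsingleton_lieH₂_iff k L).1 h))
  refine ⟨lift c halt hc ∘ₗ s, fun x y => ?_⟩
  rw [LinearMap.comp_apply, ← bracket_wedge k L, ← LinearMap.comp_apply s, hs, LinearMap.id_apply,
    lift_wedge]

lemma subsingleton_lieCohomology₂_iff {M : Type*} [AddCommGroup M] [Module k M]
    [LieRingModule L M] [LieModule k L M] [LieModule.IsTrivial L M] :
    Subsingleton (LieCohomology₂ k L M) ↔ ∀ c : L →ₗ[k] L →ₗ[k] M, (∀ x, c x x = 0) →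
      (∀ x y z, - c ⁅x, y⁆ z + c ⁅x, z⁆ y - c ⁅y, z⁆ x = 0) →
      ∃ l : L →ₗ[k] M, ∀ x y, l ⁅x, y⁆ = c x y := by
  rw [subsingleton_homologyAt_iff]
  constructor
  · intro h c halt hc
    obtain ⟨l, hl⟩ := @h ⟨c, halt⟩ (by
      ext x y z
      simp only [d₂₃_apply, trivial_lie_zero, sub_self, add_zero, zero_sub]
      exact hc x y z)
    -- With trivial coefficients the differential of l is (x, y) ↦ -l([x, y]), hence the sign.
    refine ⟨-l, fun x y => ?_⟩
    have := congrArg (fun a : twoCochain k L M => a x y) hl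
    rwa [d₁₂_apply_apply_ofTrivial] at this
  · intro h a ha
    obtain ⟨l, hl⟩ := h a.1 a.2 (fun x y z => by
      have := congrArg (fun b => b x y z) (LinearMap.mem_ker.1 ha)
      simpa [trivial_lie_zero] using this)
    refine ⟨-l, ?_⟩
    ext x y
    simpa [trivial_lie_zero] using hl x y

/-- Over a field, `H₂(L) = 0` if and only if `H²(L, M) = 0` for every trivial module `M`. -/
lemma subsingleton_lieH₂_iff_forall_lieCohomology₂ :
    Subsingleton (LieH₂ k L) ↔ ∀ (M : Type (max v w)) [AddCommGroup M] [Module k M]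
      [LieRingModule L M] [LieModule k L M] [LieModule.IsTrivial L M],
      Subsingleton (LieCohomology₂ k L M) := by
  constructor
  · intro h M _ _ _ _ _
    exact subsingleton_lieCohomology₂_iff.2 (fun c => exists_coboundary_of_subsingleton_lieH₂ h c)
  · intro h
    rw [subsingleton_lieH₂_iff, injective_iff_map_eq_zero]
    intro t ht
    by_contra ht0
    have : Nontrivial L := by
      by_contra hL
      rw [not_nontrivial_iff_subsingleton] at hL
      have : (LinearMap.id : WedgeModBoundaries k L →ₗ[k] _) = 0 := by
        ext x y; simp [Subsingleton.elim x 0]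
      exact ht0 (LinearMap.congr_fun this t)
    obtain ⟨x₀, hx₀⟩ := exists_ne (0 : L)
    obtain ⟨φ, hφ⟩ := Module.Projective.exists_dual_ne_zero k ht0
    -- The coefficients must live in `Type (max v w)`, which need not contain `k`. A functional not
    -- vanishing at t is therefore followed by the embedding of k as the line through x₀ in a lift
    -- of L; this is why L must be nonzero.
    let g : WedgeModBoundaries k L →ₗ[k] TrivialLieModule k L (ULift.{w} L) :=
      (TrivialLieModule.equiv k L (ULift.{w} L)).symm.toLinearMap ∘ₗ
        LinearMap.toSpanSingleton k _ (ULift.up x₀) ∘ₗ φ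
    obtain ⟨l, hl⟩ := subsingleton_lieCohomology₂_iff.1 (h (TrivialLieModule k L (ULift.{w} L)))
      ((wedge k L).compr₂ g) (fun x => by simp [wedge_self])
      (fun x y z => by simpa using congrArg g (wedge_cocycle k L x y z))
    have hlg : l ∘ₗ bracket k L = g := by ext x y; simp [hl]
    have h0 : g t = 0 := by rw [← hlg, LinearMap.comp_apply, ht, map_zero]
    have h1 : φ t • ULift.up.{w} x₀ = 0 := by simpa [g] using h0
    exact (smul_ne_zero hφ fun h => hx₀ (congrArg ULift.down h)) h1

end UniversalCoefficients

/-! ### Linearized Jordan identities and the symbols {a, b} -/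

section JordanIdentities

open scoped TensorProduct

variable (k : Type u) [Field k] {J : Type v} [NonAssocCommRing J] [Module k J]

/-- The fully linearized Jordan identity. -/
lemma jordan_linearized [NeZero (2 : k)] [IsCommJordan J] (a b c d : J) :
    (a * b) * (c * d) - c * ((a * b) * d) + ((b * c) * (a * d) - a * ((b * c) * d))
      + ((c * a) * (b * d) - b * ((c * a) * d)) = 0 := by
  have key : ∀ x : J, x * d * (x * x) - x * (d * (x * x)) = 0 := fun x =>
    sub_eq_zero.2 (IsCommJordan.lmul_comm_rmul_rmul x d)
  refine (smul_eq_zero.1 ?_).resolve_left (NeZero.ne (2 : k))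
  rw [two_smul]
  have h1 := key a
  have h2 := key b
  have h3 := key c
  have h4 := key (a + b)
  have h5 := key (b + c)
  have h6 := key (a + c)
  have h7 := key (a + b + c)
  simp only [mul_add, add_mul] at h4 h5 h6 h7
  -- Ordered rewriting with commutativity puts nonassociative monomials in a normal form that `abel`
  -- can compare.
  simp only [mul_comm] at *
  linear_combination (norm := abel) h7 - h4 - h5 - h6 + h1 + h2 + h3


section Commutator

variable [IsScalarTower k J J] [SMulCommClass k J J]

/-- The commutator of the multiplication operators by `a` and `b`. -/
def lmulCommutator : J →ₗ[k] J →ₗ[k] Module.End k J :=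
  LinearMap.mk₂ k (fun a b => LinearMap.mulLeft k a ∘ₗ LinearMap.mulLeft k b
      - LinearMap.mulLeft k b ∘ₗ LinearMap.mulLeft k a)
    (fun a a' b => by ext; simp [add_mul, mul_add]; abel)
    (fun c a b => by ext; simp [smul_sub, smul_mul_assoc])
    (fun a b b' => by ext; simp [add_mul, mul_add]; abel)
    (fun c a b => by ext; simp [smul_sub, smul_mul_assoc])

@[simp]
lemma lmulCommutator_apply (a b c : J) : lmulCommutator k a b c = a * (b * c) - b * (a * c) := rfl

/-- The derivation property is the difference of two instances of the linearized Jordan identity. -/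
lemma lmulCommutator_mul [NeZero (2 : k)] [IsCommJordan J] (a b c d : J) :
    lmulCommutator k a b (c * d) =
      lmulCommutator k a b c * d + c * lmulCommutator k a b d := by
  have h1 := jordan_linearized k a c d b
  have h2 := jordan_linearized k b c d a
  simp only [lmulCommutator_apply, mul_sub, sub_mul]
  simp only [mul_comm] at h1 h2 ⊢
  linear_combination (norm := abel) h2 - h1

end Commutator

/-- The relations `{a, b} = -{b, a}` and `{ab, c} + {bc, a} + {ca, b} = 0`. -/
def innerRelations (J : Type v) [NonAssocCommRing J] [Module k J] : Submodule k (J ⊗[k] J) :=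
  Submodule.span k ({t | ∃ a b : J, a ⊗ₜ[k] b + b ⊗ₜ[k] a = t} ∪
    {t | ∃ a b c : J, (a * b) ⊗ₜ[k] c + (b * c) ⊗ₜ[k] a + (c * a) ⊗ₜ[k] b = t})

/-- The space spanned by the symbols `{a, b}` for `a, b ∈ J`, which are bilinear, alternating, and
satisfy `{ab, c} + {bc, a} + {ca, b} = 0`. -/
def UniversalInner (J : Type v) [NonAssocCommRing J] [Module k J] : Type v :=
  (J ⊗[k] J) ⧸ innerRelations k J

namespace UniversalInner

instance : AddCommGroup (UniversalInner k J) :=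
  inferInstanceAs (AddCommGroup ((J ⊗[k] J) ⧸ innerRelations k J))

instance : Module k (UniversalInner k J) :=
  inferInstanceAs (Module k ((J ⊗[k] J) ⧸ innerRelations k J))

/-- The projection from the tensor square. -/
def proj : J ⊗[k] J →ₗ[k] UniversalInner k J := (innerRelations k J).mkQ

lemma proj_surjective : Function.Surjective (proj k (J := J)) := Submodule.mkQ_surjective _

/-- The symbol `{a, b}`. -/
def sym : J →ₗ[k] J →ₗ[k] UniversalInner k J :=
  (TensorProduct.mk k J J).compr₂ (proj k)

lemma sym_apply (a b : J) : sym k a b = proj k (a ⊗ₜ b) := rfl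

lemma sym_add_swap (a b : J) : sym k a b + sym k b a = 0 :=
  (Submodule.Quotient.mk_eq_zero (innerRelations k J)).2
    (Submodule.subset_span (Or.inl ⟨a, b, rfl⟩))

lemma sym_swap (a b : J) : sym k a b = - sym k b a := eq_neg_of_add_eq_zero_left (sym_add_swap k a b)

lemma sym_cyclic (a b c : J) : sym k (a * b) c + sym k (b * c) a + sym k (c * a) b = 0 :=
  (Submodule.Quotient.mk_eq_zero (innerRelations k J)).2
    (Submodule.subset_span (Or.inr ⟨a, b, c, rfl⟩))

lemma sym_one_left (a : J) : sym k 1 a = 0 := by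
  have := sym_cyclic k 1 1 a
  rw [mul_one, one_mul, mul_one, sym_swap k a 1] at this
  linear_combination (norm := abel) -this

lemma sym_one_right (a : J) : sym k a 1 = 0 := by
  rw [sym_swap, sym_one_left, neg_zero]

variable {k}

@[ext]
lemma hom_ext {M : Type*} [AddCommGroup M] [Module k M] {φ ψ : UniversalInner k J →ₗ[k] M}
    (h : ∀ a b, φ (sym k a b) = ψ (sym k a b)) : φ = ψ := by
  rw [← LinearMap.cancel_right (proj_surjective k)]
  exact TensorProduct.ext' h

/-- The universal property of the space of symbols. -/
def lift {M : Type*} [AddCommGroup M] [Module k M] (φ : J →ₗ[k] J →ₗ[k] M)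
    (hs : ∀ a b, φ a b + φ b a = 0)
    (hc : ∀ a b c, φ (a * b) c + φ (b * c) a + φ (c * a) b = 0) : UniversalInner k J →ₗ[k] M :=
  (innerRelations k J).liftQ (TensorProduct.lift φ) (by
    rw [innerRelations, Submodule.span_le]
    rintro _ (⟨a, b, rfl⟩ | ⟨a, b, c, rfl⟩)
    · simpa using hs a b
    · simpa using hc a b c)

@[simp]
lemma lift_sym {M : Type*} [AddCommGroup M] [Module k M] (φ : J →ₗ[k] J →ₗ[k] M)
    (hs : ∀ a b, φ a b + φ b a = 0)
    (hc : ∀ a b c, φ (a * b) c + φ (b * c) a + φ (c * a) b = 0) (a b : J) :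
    lift φ hs hc (sym k a b) = φ a b := by
  refine (Submodule.liftQ_apply _ _ _).trans ?_
  exact TensorProduct.lift.tmul _ _

@[elab_as_elim]
lemma induction {p : UniversalInner k J → Prop} (x : UniversalInner k J) (zero : p 0)
    (sym : ∀ a b, p (sym k a b)) (add : ∀ x y, p x → p y → p (x + y)) : p x := by
  obtain ⟨t, rfl⟩ := proj_surjective k x
  induction t with
  | zero => rwa [map_zero]
  | tmul a b => exact sym a b
  | add s t hs ht => rw [map_add]; exact add _ _ hs ht

/-- The action of a derivation of `J` on the space of symbols. -/
def ofDerivation (D : Module.End k J) (hD : ∀ a b, D (a * b) = D a * b + a * D b) :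
    Module.End k (UniversalInner k J) :=
  lift ((sym k).comp D + (sym k).compl₂ D)
    (fun a b => by
      simp only [LinearMap.add_apply, LinearMap.comp_apply, LinearMap.compl₂_apply]
      rw [sym_swap k (D a) b, sym_swap k (D b) a]
      abel)
    (fun a b c => by
      have h1 := sym_cyclic k (D a) b c
      have h2 := sym_cyclic k a (D b) c
      have h3 := sym_cyclic k a b (D c)
      simp only [LinearMap.add_apply, LinearMap.comp_apply, LinearMap.compl₂_apply, hD, map_add]
      linear_combination (norm := abel) h1 + h2 + h3)

@[simp]
lemma ofDerivation_sym (D : Module.End k J) (hD : ∀ a b, D (a * b) = D a * b + a * D b) (a b : J) :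
    ofDerivation D hD (sym k a b) = sym k (D a) b + sym k a (D b) := lift_sym _ _ _ _ _

variable [IsScalarTower k J J] [SMulCommClass k J J]

/-- This gives antisymmetry of the bracket of symbols. It follows from four instances of the cyclic
relation, without the Jordan identity. -/
lemma sym_lmulCommutator (a b c d : J) :
    sym k (lmulCommutator k a b c) d + sym k c (lmulCommutator k a b d) =
      - (sym k (lmulCommutator k c d a) b + sym k a (lmulCommutator k c d b)) := by
  have h1 := sym_cyclic k a (b * c) d
  have h2 := sym_cyclic k b (a * c) d
  have h3 := sym_cyclic k a (b * d) c
  have h4 := sym_cyclic k b (a * d) c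
  simp only [lmulCommutator_apply, map_sub, LinearMap.sub_apply]
  rw [sym_swap k c (a * (b * d)), sym_swap k c (b * (a * d)), sym_swap k (c * (d * a)) b,
    sym_swap k (d * (c * a)) b]
  rw [sym_swap k _ a, sym_swap k (d * a) _] at h1
  rw [sym_swap k _ b, sym_swap k (d * b) _] at h2
  rw [sym_swap k _ a] at h3
  rw [sym_swap k _ b] at h4
  simp only [mul_comm] at *
  linear_combination (norm := abel) h1 - h2 - h3 + h4

variable [NeZero (2 : k)] [IsCommJordan J]

/-- The symbol `{a, b}` acts on `J` as the commutator of the multiplications by `a` and `b`. -/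
def der : UniversalInner k J →ₗ[k] Module.End k J :=
  lift (lmulCommutator k) (fun a b => by ext; simp) (fun a b c => by
    ext d
    -- Evaluated at d, the cyclic relation for commutators of multiplications is the linearized
    -- Jordan identity.
    exact jordan_linearized k a b c d)

@[simp]
lemma der_sym (a b : J) : der (sym k a b) = lmulCommutator k a b := lift_sym _ _ _ _ _

lemma der_mul (x : UniversalInner k J) (a b : J) : der x (a * b) = der x a * b + a * der x b := by
  induction x using induction with
  | zero => simp
  | sym a b => simpa only [der_sym] using lmulCommutator_mul k _ _ _ _
  | add x y hx hy => simp only [map_add, LinearMap.add_apply, hx, hy, add_mul, mul_add]; abel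

@[simp]
lemma der_one (x : UniversalInner k J) : der x 1 = 0 := by
  have h := der_mul x 1 1
  rw [mul_one, mul_one, one_mul] at h
  exact left_eq_add.1 h

/-- The bracket of inner symbols. -/
def bracket : UniversalInner k J →ₗ[k] UniversalInner k J →ₗ[k] UniversalInner k J where
  -- The first argument acts as a derivation on symbols; antisymmetry is not built in and is proved
  -- in `bracket_skew`.
  toFun x := ofDerivation (der x) (der_mul x)
  map_add' x y := by ext; simp; abel
  map_smul' c x := by ext; simp

@[simp]
lemma bracket_sym (x : UniversalInner k J) (a b : J) :
    bracket x (sym k a b) = sym k (der x a) b + sym k a (der x b) :=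
  ofDerivation_sym _ (der_mul x) _ _

lemma bracket_skew (x y : UniversalInner k J) : bracket x y = - bracket y x := by
  induction x using induction with
  | zero => simp
  | add x x' hx hx' => rw [map_add, LinearMap.add_apply, hx, hx', map_add, neg_add]
  | sym a b =>
    induction y using induction with
    | zero => simp
    | add x x' hx hx' => rw [map_add, map_add, LinearMap.add_apply, hx, hx', neg_add]
    | sym c d => simpa only [bracket_sym, der_sym] using sym_lmulCommutator a b c d

/-- Used to show that the kernel of `counit` is central. -/
lemma bracket_eq_zero_of_der_eq_zero {x : UniversalInner k J} (hx : der x = 0)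
    (y : UniversalInner k J) : bracket x y = 0 := by
  induction y using induction with
  | zero => simp
  | sym a b => simp [hx]
  | add y y' hy hy' => rw [map_add, hy, hy', add_zero]

lemma der_bracket (x y : UniversalInner k J) (a : J) :
    der (bracket x y) a = der x (der y a) - der y (der x a) := by
  induction y using induction with
  | zero => simp
  | add y y' hy hy' => simp only [map_add, LinearMap.add_apply, hy, hy']; abel
  | sym b c =>
    simp only [bracket_sym, map_add, der_sym, LinearMap.add_apply, lmulCommutator_apply, map_sub,
      der_mul, mul_add]
    abel

lemma leibniz_bracket (x y z : UniversalInner k J) :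
    bracket x (bracket y z) = bracket (bracket x y) z + bracket y (bracket x z) := by
  induction z using induction with
  | zero => simp
  | add y y' hy hy' => simp only [map_add, hy, hy']; abel
  | sym b c =>
    simp only [bracket_sym, map_add, der_bracket, map_sub, LinearMap.sub_apply]
    abel

end UniversalInner

end JordanIdentities

/-! ### The Tits–Allison–Gao Lie algebra -/

/-- The Tits–Allison–Gao algebra of a Jordan algebra `J`: the space `sl₂ ⊗ J ⊕ {J, J}`, written in
coordinates with respect to the basis `½e, ½h, f` of `sl₂`. -/
@[ext]
structure TitsAllisonGao (k : Type u) [Field k] (J : Type v) [NonAssocCommRing J] [Module k J] where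
  e : J
  h : J
  f : J
  inner : UniversalInner k J

namespace TitsAllisonGao

open UniversalInner

variable (k : Type u) [Field k] (J : Type v) [NonAssocCommRing J] [Module k J]

/-- The underlying product. -/
def equivProd : TitsAllisonGao k J ≃ J × J × J × UniversalInner k J where
  toFun x := (x.e, x.h, x.f, x.inner)
  invFun x := ⟨x.1, x.2.1, x.2.2.1, x.2.2.2⟩

instance : AddCommGroup (TitsAllisonGao k J) := (equivProd k J).addCommGroup
instance : Module k (TitsAllisonGao k J) := (equivProd k J).module k

variable {k J}

section
variable (x y : TitsAllisonGao k J) (c : k)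
@[simp] lemma add_e : (x + y).e = x.e + y.e := rfl
@[simp] lemma add_h : (x + y).h = x.h + y.h := rfl
@[simp] lemma add_f : (x + y).f = x.f + y.f := rfl
@[simp] lemma add_inner : (x + y).inner = x.inner + y.inner := rfl
@[simp] lemma sub_e : (x - y).e = x.e - y.e := rfl
@[simp] lemma sub_h : (x - y).h = x.h - y.h := rfl
@[simp] lemma sub_f : (x - y).f = x.f - y.f := rfl
@[simp] lemma sub_inner : (x - y).inner = x.inner - y.inner := rfl
@[simp] lemma neg_e : (-x).e = -x.e := rfl
@[simp] lemma neg_h : (-x).h = -x.h := rfl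
@[simp] lemma neg_f : (-x).f = -x.f := rfl
@[simp] lemma neg_inner : (-x).inner = -x.inner := rfl
@[simp] lemma zero_e : (0 : TitsAllisonGao k J).e = 0 := rfl
@[simp] lemma zero_h : (0 : TitsAllisonGao k J).h = 0 := rfl
@[simp] lemma zero_f : (0 : TitsAllisonGao k J).f = 0 := rfl
@[simp] lemma zero_inner : (0 : TitsAllisonGao k J).inner = 0 := rfl
@[simp] lemma smul_e : (c • x).e = c • x.e := rfl
@[simp] lemma smul_h : (c • x).h = c • x.h := rfl
@[simp] lemma smul_f : (c • x).f = c • x.f := rfl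
@[simp] lemma smul_inner : (c • x).inner = c • x.inner := rfl
end

variable (k)

/-- The copy `½e ⊗ J` of `J`. -/
@[simps]
def ιE : J →ₗ[k] TitsAllisonGao k J where
  toFun a := ⟨a, 0, 0, 0⟩
  map_add' a b := by ext <;> simp
  map_smul' a b := by ext <;> simp

/-- The copy `½h ⊗ J` of `J`. -/
@[simps]
def ιH : J →ₗ[k] TitsAllisonGao k J where
  toFun a := ⟨0, a, 0, 0⟩
  map_add' a b := by ext <;> simp
  map_smul' a b := by ext <;> simp

/-- The copy `f ⊗ J` of `J`. -/
@[simps]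
def ιF : J →ₗ[k] TitsAllisonGao k J where
  toFun a := ⟨0, 0, a, 0⟩
  map_add' a b := by ext <;> simp
  map_smul' a b := by ext <;> simp

variable {k}

/-- The inclusion of `{J, J}`. -/
@[simps]
def ιInner : UniversalInner k J →ₗ[k] TitsAllisonGao k J where
  toFun a := ⟨0, 0, 0, a⟩
  map_add' a b := by ext <;> simp
  map_smul' a b := by ext <;> simp

lemma eq_sum (x : TitsAllisonGao k J) :
    x = ιE k x.e + ιH k x.h + ιF k x.f + ιInner x.inner := by ext <;> simp

variable [IsScalarTower k J J] [SMulCommClass k J J] [NeZero (2 : k)] [IsCommJordan J]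

instance : Bracket (TitsAllisonGao k J) (TitsAllisonGao k J) where
  bracket x y :=
    -- In the basis ½e, ½h, f all structure constants are ±1, so no scalars appear.
    { e := x.h * y.e - y.h * x.e + der x.inner y.e - der y.inner x.e
      h := x.e * y.f - y.e * x.f + der x.inner y.h - der y.inner x.h
      f := y.h * x.f - x.h * y.f + der x.inner y.f - der y.inner x.f
      inner := sym k x.e y.f + sym k x.f y.e + sym k x.h y.h + bracket x.inner y.inner }

section
variable (x y : TitsAllisonGao k J)

@[simp] lemma lie_e : ⁅x, y⁆.e =
    x.h * y.e - y.h * x.e + der x.inner y.e - der y.inner x.e := rfl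

@[simp] lemma lie_h : ⁅x, y⁆.h =
    x.e * y.f - y.e * x.f + der x.inner y.h - der y.inner x.h := rfl

@[simp] lemma lie_f : ⁅x, y⁆.f =
    y.h * x.f - x.h * y.f + der x.inner y.f - der y.inner x.f := rfl

@[simp] lemma lie_inner : ⁅x, y⁆.inner =
    sym k x.e y.f + sym k x.f y.e + sym k x.h y.h + bracket x.inner y.inner := rfl

end

lemma leibniz_e (x y z : TitsAllisonGao k J) : ⁅x, ⁅y, z⁆⁆.e = ⁅⁅x, y⁆, z⁆.e + ⁅y, ⁅x, z⁆⁆.e := by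
  simp only [lie_e, lie_h, lie_inner, map_add, map_sub, mul_add, mul_sub, add_mul, sub_mul,
    LinearMap.add_apply, der_bracket, der_sym, lmulCommutator_apply, der_mul]
  simp only [mul_comm]
  abel

lemma leibniz_h (x y z : TitsAllisonGao k J) : ⁅x, ⁅y, z⁆⁆.h = ⁅⁅x, y⁆, z⁆.h + ⁅y, ⁅x, z⁆⁆.h := by
  simp only [lie_e, lie_h, lie_f, lie_inner, map_add, map_sub, mul_add, mul_sub, add_mul, sub_mul,
    LinearMap.add_apply, der_bracket, der_sym, lmulCommutator_apply, der_mul]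
  simp only [mul_comm]
  abel

lemma leibniz_f (x y z : TitsAllisonGao k J) : ⁅x, ⁅y, z⁆⁆.f = ⁅⁅x, y⁆, z⁆.f + ⁅y, ⁅x, z⁆⁆.f := by
  simp only [lie_h, lie_f, lie_inner, map_add, map_sub, mul_add, mul_sub, add_mul, sub_mul,
    LinearMap.add_apply, der_bracket, der_sym, lmulCommutator_apply, der_mul]
  simp only [mul_comm]
  abel

/-- Here the cyclic relation is needed: its six instances are the six ways of taking one e-, one h-
and one f-coordinate from x, y, z. -/
lemma leibniz_inner (x y z : TitsAllisonGao k J) :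
    ⁅x, ⁅y, z⁆⁆.inner = ⁅⁅x, y⁆, z⁆.inner + ⁅y, ⁅x, z⁆⁆.inner := by
  have h1 := sym_cyclic k x.e y.h z.f
  have h2 := sym_cyclic k x.e y.f z.h
  have h3 := sym_cyclic k x.h y.e z.f
  have h4 := sym_cyclic k x.h y.f z.e
  have h5 := sym_cyclic k x.f y.e z.h
  have h6 := sym_cyclic k x.f y.h z.e
  have hb (a b : J) (d : UniversalInner k J) : bracket (sym k a b) d =
      - (sym k (der d a) b + sym k a (der d b)) := by rw [bracket_skew, bracket_sym]
  have hm (a b c : J) : sym k (a * b) c = - sym k c (a * b) := sym_swap k _ _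
  have hd (a b : J) (d : UniversalInner k J) : sym k (der d a) b = - sym k b (der d a) :=
    sym_swap k _ _
  simp only [lie_e, lie_h, lie_f, lie_inner, map_add, map_sub, LinearMap.add_apply,
    LinearMap.sub_apply, bracket_sym, hb, hm, hd, leibniz_bracket x.inner] at *
  simp only [mul_comm] at *
  linear_combination (norm := abel) h1 - h2 - h3 + h4 + h5 - h6

instance : LieRing (TitsAllisonGao k J) where
  add_lie x y z := by
    ext <;> simp only [lie_e, lie_h, lie_f, lie_inner, add_e, add_h, add_f, add_inner, map_add,
      mul_add, add_mul, LinearMap.add_apply] <;> abel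
  lie_add x y z := by
    ext <;> simp only [lie_e, lie_h, lie_f, lie_inner, add_e, add_h, add_f, add_inner, map_add,
      mul_add, add_mul, LinearMap.add_apply] <;> abel
  lie_self x := by
    have h : bracket x.inner x.inner = 0 := by
      refine (smul_eq_zero.1 ?_).resolve_left (NeZero.ne (2 : k))
      rw [two_smul]
      nth_rw 1 [bracket_skew, neg_add_cancel]
    have h' : sym k x.h x.h = 0 := by
      refine (smul_eq_zero.1 ?_).resolve_left (NeZero.ne (2 : k))
      rw [two_smul, sym_add_swap]
    ext <;> simp [h, h', sym_add_swap]
  leibniz_lie x y z := by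
    ext
    · exact leibniz_e x y z
    · exact leibniz_h x y z
    · exact leibniz_f x y z
    · exact leibniz_inner x y z

instance : LieAlgebra k (TitsAllisonGao k J) where
  lie_smul c x y := by ext <;> simp [smul_sub, smul_add, mul_smul_comm, smul_mul_assoc]

end TitsAllisonGao

/-! ### Coordinatization and the universal property -/

section Coordinatization

open UniversalInner

/-- Maps `E : J → K` that, together with the element `f`, look like `a ↦ ½e ⊗ a` and `f ⊗ 1` in
a Lie algebra coordinatized by `J`. -/
structure IsCoordinatization {k : Type u} [Field k] {J : Type v} [NonAssocCommRing J]
    [Module k J] {K : Type w} [LieRing K] [LieAlgebra k K] (E : J →ₗ[k] K) (f : K) : Prop where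
  lie_E_E : ∀ a b, ⁅E a, E b⁆ = 0
  lie_lie_E_f_E : ∀ a b, ⁅⁅E a, f⁆, E b⁆ = E (a * b)
  lie_lie_E_one_f : ⁅⁅E 1, f⁆, f⁆ = -f
  lie_f_f : ∀ a, ⁅⁅⁅E a, f⁆, f⁆, f⁆ = 0

namespace IsCoordinatization

variable {k : Type u} [Field k] {J : Type v} [NonAssocCommRing J] [Module k J]
  {K : Type w} [LieRing K] [LieAlgebra k K]

/-- The map `a ↦ ½h ⊗ a`. -/
def H (E : J →ₗ[k] K) (f : K) : J →ₗ[k] K where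
  toFun a := ⁅E a, f⁆
  map_add' a b := by simp
  map_smul' c a := by simp

/-- The map `a ↦ f ⊗ a`. -/
def F (E : J →ₗ[k] K) (f : K) : J →ₗ[k] K where
  toFun a := -⁅⁅E a, f⁆, f⁆
  map_add' a b := by simp only [map_add, add_lie, neg_add]
  map_smul' c a := by simp only [map_smul, smul_lie, smul_neg, RingHom.id_apply]

variable {E : J →ₗ[k] K} {f : K}

lemma lie_E_f (a : J) : ⁅E a, f⁆ = H E f a := rfl

lemma lie_H_f (a : J) : ⁅H E f a, f⁆ = - F E f a := (neg_neg _).symm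

variable (C : IsCoordinatization E f)
include C

lemma F_one : F E f 1 = f := neg_eq_iff_eq_neg.2 C.lie_lie_E_one_f

lemma lie_F_f (a : J) : ⁅F E f a, f⁆ = 0 := by
  rw [show F E f a = -⁅⁅E a, f⁆, f⁆ from rfl, neg_lie, C.lie_f_f, neg_zero]

lemma lie_H_E (a b : J) : ⁅H E f a, E b⁆ = E (a * b) := C.lie_lie_E_f_E a b

lemma lie_E_H (a b : J) : ⁅E a, H E f b⁆ = - E (a * b) := by
  rw [← lie_skew, C.lie_H_E, mul_comm]

lemma lie_E_F' (a b : J) : ⁅E b, F E f a⁆ = H E f (a * b) - ⁅H E f a, H E f b⁆ := by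
  have h := leibniz_lie (H E f a) (E b) f
  rw [C.lie_H_E, lie_H_f, lie_neg, lie_E_f (E := E) (f := f), lie_E_f (E := E) (f := f)] at h
  linear_combination (norm := abel) h

lemma lie_E_F (a b : J) : ⁅E a, F E f b⁆ = H E f (a * b) + ⁅H E f a, H E f b⁆ := by
  rw [C.lie_E_F', mul_comm b a, ← lie_skew (H E f a), sub_eq_add_neg]

lemma lie_F_E (a b : J) : ⁅F E f a, E b⁆ = - H E f (a * b) + ⁅H E f a, H E f b⁆ := by
  rw [← lie_skew, C.lie_E_F', neg_sub, sub_eq_add_neg, add_comm]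

lemma lie_H_F' (a b : J) : ⁅H E f b, F E f a⁆ = - F E f (a * b) + ⁅⁅H E f b, H E f a⁆, f⁆ := by
  have h := leibniz_lie (E b) (F E f a) f
  rw [C.lie_F_f, lie_zero, lie_E_f (E := E) (f := f), C.lie_E_F, add_lie, lie_H_f, mul_comm b a,
    ← lie_skew (F E f a)] at h
  linear_combination (norm := abel) h

variable [NeZero (3 : k)]

/-- Let X be the left side. By Jacobi X = [H b, F a] - [H a, F b], and `lie_H_F'` evaluates this as
-2X, so 3X = 0. -/
lemma lie_lie_H_H_f (a b : J) : ⁅⁅H E f a, H E f b⁆, f⁆ = 0 := by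
  refine (smul_eq_zero.1 ?_).resolve_left (NeZero.ne (3 : k))
  have h1 := C.lie_H_F' a b
  have h2 := C.lie_H_F' b a
  have h3 := leibniz_lie (H E f a) (H E f b) f
  rw [lie_H_f, lie_H_f, lie_neg, lie_neg, h1, h2, ← lie_skew (H E f b), neg_lie, mul_comm b a] at h3
  rw [show (3 : k) = 1 + 1 + 1 by norm_num, add_smul, add_smul, one_smul]
  linear_combination (norm := abel) -h3

lemma lie_H_F (a b : J) : ⁅H E f a, F E f b⁆ = - F E f (a * b) := by
  rw [C.lie_H_F', C.lie_lie_H_H_f, add_zero, mul_comm]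

lemma lie_F_H (a b : J) : ⁅F E f a, H E f b⁆ = F E f (a * b) := by
  rw [← lie_skew, C.lie_H_F, neg_neg, mul_comm]

lemma lie_F_F (a b : J) : ⁅F E f a, F E f b⁆ = 0 := by
  have h := leibniz_lie (H E f a) (F E f b) f
  rw [C.lie_F_f, lie_zero, C.lie_H_F, neg_lie, C.lie_F_f, lie_H_f, lie_neg, ← lie_skew] at h
  simpa using h.symm

omit [NeZero (3 : k)] in
lemma lie_lie_H_H_E (a b c : J) :
    ⁅⁅H E f a, H E f b⁆, E c⁆ = E (a * (b * c) - b * (a * c)) := by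
  rw [lie_lie, C.lie_H_E, C.lie_H_E, C.lie_H_E, C.lie_H_E, map_sub]

lemma lie_lie_H_H_H (a b c : J) :
    ⁅⁅H E f a, H E f b⁆, H E f c⁆ = H E f (a * (b * c) - b * (a * c)) := by
  rw [← lie_E_f c, leibniz_lie, C.lie_lie_H_H_E, C.lie_lie_H_H_f, lie_zero, add_zero, lie_E_f]

lemma lie_lie_H_H_F (a b c : J) :
    ⁅⁅H E f a, H E f b⁆, F E f c⁆ = F E f (a * (b * c) - b * (a * c)) := by
  rw [← neg_inj, ← lie_neg, ← lie_H_f c, leibniz_lie, C.lie_lie_H_H_H, C.lie_lie_H_H_f, lie_zero,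
    add_zero, lie_H_f]

/-- Apply ad (H c) to [E a, F b] = H(ab) + [H a, H b]: the terms in the image of H cancel, and the
cyclic relation remains. -/
lemma lie_H_H_cyclic (a b c : J) :
    ⁅H E f (a * b), H E f c⁆ + ⁅H E f (b * c), H E f a⁆ + ⁅H E f (c * a), H E f b⁆ = 0 := by
  have h := leibniz_lie (H E f c) (E a) (F E f b)
  have h' : ⁅H E f c, ⁅H E f a, H E f b⁆⁆ = - H E f (a * (b * c) - b * (a * c)) := by
    rw [← lie_skew, C.lie_lie_H_H_H]
  rw [C.lie_E_F, C.lie_H_E, C.lie_H_F, lie_neg, C.lie_E_F, C.lie_E_F, lie_add, h',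
    ← lie_skew _ (H E f (a * b))] at h
  rw [← lie_skew _ (H E f a)]
  simp only [mul_comm] at *
  linear_combination (norm := (simp only [map_sub]; abel)) -h

/-- The Jordan identity holds in any algebra that coordinatizes a Lie algebra. -/
lemma jordan (hE : Function.Injective E) (a b : J) : a * b * (a * a) = a * (b * (a * a)) := by
  -- The cyclic relation at a, a, a gives 3[H(a²), H a] = 0; acting on E b, this says that
  -- multiplications by a² and a commute.
  have h := C.lie_H_H_cyclic a a a
  have h0 : ⁅H E f (a * a), H E f a⁆ = 0 := by
    refine (smul_eq_zero.1 ?_).resolve_left (NeZero.ne (3 : k))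
    rw [show (3 : k) = 1 + 1 + 1 by norm_num, add_smul, add_smul, one_smul, h]
  apply hE
  have := lie_lie (H E f (a * a)) (H E f a) (E b)
  rw [h0, zero_lie, C.lie_H_E, C.lie_H_E, C.lie_H_E, C.lie_H_E] at this
  rw [mul_comm _ (a * a), mul_comm b]
  exact sub_eq_zero.1 this.symm


/-- The map `{a, b} ↦ [H a, H b]`. -/
def inner : UniversalInner k J →ₗ[k] K :=
  lift (LinearMap.compl₁₂ (LieModule.toEnd k K K : K →ₗ[k] Module.End k K) (H E f) (H E f))
    (fun a b => by
      simp only [LinearMap.compl₁₂_apply, LieHom.coe_toLinearMap, LieModule.toEnd_apply_apply]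
      rw [← lie_skew, neg_add_cancel])
    (fun a b c => C.lie_H_H_cyclic a b c)

@[simp]
lemma inner_sym (a b : J) : C.inner (sym k a b) = ⁅H E f a, H E f b⁆ := lift_sym _ _ _ _ _

variable [IsScalarTower k J J] [SMulCommClass k J J] [NeZero (2 : k)] [IsCommJordan J]

lemma lie_inner_E (x : UniversalInner k J) (a : J) : ⁅C.inner x, E a⁆ = E (der x a) := by
  induction x using UniversalInner.induction with
  | zero => simp
  | sym b c => rw [inner_sym, C.lie_lie_H_H_E, der_sym, lmulCommutator_apply]
  | add x y hx hy => simp [hx, hy]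

lemma lie_inner_H (x : UniversalInner k J) (a : J) :
    ⁅C.inner x, H E f a⁆ = H E f (der x a) := by
  induction x using UniversalInner.induction with
  | zero => simp
  | sym b c => rw [inner_sym, C.lie_lie_H_H_H, der_sym, lmulCommutator_apply]
  | add x y hx hy => simp [hx, hy]

lemma lie_inner_F (x : UniversalInner k J) (a : J) :
    ⁅C.inner x, F E f a⁆ = F E f (der x a) := by
  induction x using UniversalInner.induction with
  | zero => simp
  | sym b c => rw [inner_sym, C.lie_lie_H_H_F, der_sym, lmulCommutator_apply]
  | add x y hx hy => simp [hx, hy]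

lemma lie_inner_inner (x y : UniversalInner k J) :
    ⁅C.inner x, C.inner y⁆ = C.inner (bracket x y) := by
  induction y using UniversalInner.induction with
  | zero => simp
  | sym b c =>
    rw [inner_sym, leibniz_lie, lie_inner_H, lie_inner_H, bracket_sym, map_add, inner_sym, inner_sym]
  | add x y hx hy => simp [hx, hy]

/-- The Lie algebra homomorphism from the Tits–Allison–Gao algebra. -/
def toLieHom : TitsAllisonGao k J →ₗ⁅k⁆ K where
  toFun x := E x.e + H E f x.h + F E f x.f + C.inner x.inner
  map_add' x y := by simp; abel
  map_smul' c x := by simp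
  map_lie' {x y} := by
    have hE (a) (z : UniversalInner k J) : ⁅E a, C.inner z⁆ = - E (der z a) := by
      rw [← lie_skew, lie_inner_E]
    have hH (a) (z : UniversalInner k J) : ⁅H E f a, C.inner z⁆ = - H E f (der z a) := by
      rw [← lie_skew, lie_inner_H]
    have hF (a) (z : UniversalInner k J) : ⁅F E f a, C.inner z⁆ = - F E f (der z a) := by
      rw [← lie_skew, lie_inner_F]
    simp only [TitsAllisonGao.lie_e, TitsAllisonGao.lie_h, TitsAllisonGao.lie_f,
      TitsAllisonGao.lie_inner, map_add, map_sub, inner_sym, lie_add, add_lie, hE, hH, hF,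
      lie_inner_E, lie_inner_H, lie_inner_F, lie_inner_inner, C.lie_E_E, C.lie_E_H, C.lie_H_E,
      C.lie_E_F, C.lie_F_E, C.lie_H_F, C.lie_F_H, C.lie_F_F]
    simp only [mul_comm]
    abel

lemma toLieHom_apply (x : TitsAllisonGao k J) :
    C.toLieHom x = E x.e + H E f x.h + F E f x.f + C.inner x.inner := rfl

end IsCoordinatization

namespace TitsAllisonGao

variable (k : Type u) [Field k] (J : Type v) [NonAssocCommRing J] [Module k J]
  [IsScalarTower k J J] [SMulCommClass k J J] [NeZero (2 : k)] [IsCommJordan J]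

lemma lie_ιE_ιF_one (a : J) : ⁅ιE k a, ιF k 1⁆ = ιH k a := by
  ext <;> simp [sym_one_right]

lemma lie_ιH_ιF_one (a : J) : ⁅ιH k a, ιF k 1⁆ = - ιF k a := by
  rw [eq_neg_iff_add_eq_zero]
  ext <;> simp

lemma isCoordinatization : IsCoordinatization (ιE k (J := J)) (ιF k 1) where
  lie_E_E a b := by ext <;> simp
  lie_lie_E_f_E a b := by rw [lie_ιE_ιF_one]; ext <;> simp
  lie_lie_E_one_f := by rw [lie_ιE_ιF_one, lie_ιH_ιF_one]
  lie_f_f a := by rw [lie_ιE_ιF_one, lie_ιH_ιF_one, neg_lie, neg_eq_zero]; ext <;> simp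

variable {k J}

lemma lie_ιH_ιH (a b : J) : ⁅ιH k a, ιH k b⁆ = ιInner (sym k a b) := by
  ext <;> simp

/-- The Tits–Allison–Gao algebra is generated by `½e ⊗ J` and `f`. -/
lemma eq_on {K : Type w} [LieRing K] [LieAlgebra k K] {φ ψ : TitsAllisonGao k J →ₗ⁅k⁆ K}
    (hE : ∀ a, φ (ιE k a) = ψ (ιE k a)) (hf : φ (ιF k 1) = ψ (ιF k 1)) : φ = ψ := by
  have hH (a) : φ (ιH k a) = ψ (ιH k a) := by
    rw [← lie_ιE_ιF_one, LieHom.map_lie, LieHom.map_lie, hE, hf]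
  have hF (a) : φ (ιF k a) = ψ (ιF k a) := by
    rw [← neg_inj, ← map_neg φ, ← map_neg ψ, ← lie_ιH_ιF_one, LieHom.map_lie,
      LieHom.map_lie, hH, hf]
  have hI : (φ : TitsAllisonGao k J →ₗ[k] K) ∘ₗ ιInner =
      (ψ : TitsAllisonGao k J →ₗ[k] K) ∘ₗ ιInner := by
    ext a b
    simp [← lie_ιH_ιH, hH]
  ext x
  rw [eq_sum x]
  simp only [map_add, hE, hH, hF]
  congr 1
  exact LinearMap.congr_fun hI x.inner

end TitsAllisonGao

end Coordinatization

namespace IsCoordinatization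

variable {k : Type u} [Field k] {J : Type v} [NonAssocCommRing J] [Module k J]
  [IsScalarTower k J J] [SMulCommClass k J J] [NeZero (2 : k)] [NeZero (3 : k)] [IsCommJordan J]
  {K : Type w} [LieRing K] [LieAlgebra k K] {E : J →ₗ[k] K} {f : K} (C : IsCoordinatization E f)

@[simp]
lemma toLieHom_ιE (a : J) : C.toLieHom (TitsAllisonGao.ιE k a) = E a := by
  simp [toLieHom_apply]

@[simp]
lemma toLieHom_ιF_one : C.toLieHom (TitsAllisonGao.ιF k 1) = f := by
  simp [toLieHom_apply, C.F_one]

end IsCoordinatization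

/-! ### Splitting of central extensions and vanishing of H₂ -/

namespace TitsAllisonGao

open UniversalInner LieModule.Cohomology

variable {k : Type u} [Field k] {J : Type v} [NonAssocCommRing J] [Module k J]
  [IsScalarTower k J J] [SMulCommClass k J J] [NeZero (2 : k)] [IsCommJordan J]

lemma lie_ιH_one (x : TitsAllisonGao k J) : ⁅ιH k (1 : J), x⁆ = ιE k x.e - ιF k x.f := by
  rw [eq_sub_iff_add_eq]
  ext <;> simp [sym_one_left]

lemma lie_ιH_ιE (a b : J) : ⁅ιH k a, ιE k b⁆ = ιE k (a * b) := by ext <;> simp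

lemma lie_ιE_ιF (a b : J) : ⁅ιE k a, ιF k b⁆ = ιH k (a * b) + ιInner (sym k a b) := by
  ext <;> simp

lemma lie_ιF_ιF (a b : J) : ⁅ιF k a, ιF k b⁆ = 0 := by ext <;> simp

lemma lie_ιE_ιE (a b : J) : ⁅ιE k a, ιE k b⁆ = 0 := by ext <;> simp

variable [NeZero (3 : k)]

/-- Central extensions of the Tits–Allison–Gao algebra split. -/
lemma exists_section_of_central {K : Type w} [LieRing K] [LieAlgebra k K]
    (p : K →ₗ⁅k⁆ TitsAllisonGao k J) (hp : Function.Surjective p)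
    (hcent : ∀ x, p x = 0 → ∀ y : K, ⁅x, y⁆ = 0) :
    ∃ s : TitsAllisonGao k J →ₗ⁅k⁆ K, p.comp s = LieHom.id := by
  obtain ⟨σ, hσ⟩ := (p : K →ₗ[k] TitsAllisonGao k J).exists_rightInverse_of_surjective
    (LinearMap.range_eq_top.2 hp)
  have hσ (x) : p (σ x) = x := LinearMap.congr_fun hσ x
  have congr_left {x x' : K} (y : K) (h : p x = p x') : ⁅x, y⁆ = ⁅x', y⁆ := by
    rw [← sub_eq_zero, ← sub_lie]
    exact hcent _ (by rw [map_sub, h, sub_self]) y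
  have congr_right {y y' : K} (x : K) (h : p y = p y') : ⁅x, y⁆ = ⁅x, y'⁆ := by
    rw [← lie_skew, congr_left x h, lie_skew]
  have eq_zero {z : K} (h : z + z = 0) : z = 0 :=
    (smul_eq_zero.1 (by rwa [two_smul])).resolve_left (NeZero.ne (2 : k))
  -- Bracketing with h once more turns lifts into exact weight vectors: [h, ·] sees only images, so
  -- [h, E a] = E a and [h, f] = -f hold in K itself.
  let h : K := σ (ιH k 1)
  let E : J →ₗ[k] K :=
    { toFun := fun a => ⁅h, σ (ιE k a)⁆
      map_add' := by simp
      map_smul' := by simp }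
  let f : K := - ⁅h, σ (ιF k 1)⁆
  have hE (a) : p (E a) = ιE k a := by
    change p ⁅h, σ (ιE k a)⁆ = _
    rw [LieHom.map_lie, hσ, hσ, lie_ιH_ιE, one_mul]
  have hf : p f = ιF k 1 := by
    change p (- ⁅h, σ (ιF k 1)⁆) = _
    rw [map_neg, LieHom.map_lie, hσ, hσ, lie_ιH_ιF_one, neg_neg]
  have hhE (a) : ⁅h, E a⁆ = E a := congr_right h (by rw [hE, hσ])
  have hhf : ⁅h, f⁆ = -f := by
    rw [neg_neg]
    exact congr_right h (by rw [hf, hσ])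
  have hH (a) : p ⁅E a, f⁆ = ιH k a := by
    rw [LieHom.map_lie, hE, hf, lie_ιE_ιF_one]
  have hF (a) : p ⁅⁅E a, f⁆, f⁆ = - ιF k a := by
    rw [LieHom.map_lie, hH, hf, lie_ιH_ιF_one]
  clear_value f
  have C : IsCoordinatization E f :=
    -- The bracket z = [E a, E b] lies in the central kernel, so [h, z] = 0, while its weight gives
    -- [h, z] = 2z. The relation `lie_f_f` is the same argument in weight -2.
    { lie_E_E := fun a b => eq_zero (by
        have hz := congr_right (y := ⁅E a, E b⁆) (y' := 0) h (by
          rw [LieHom.map_lie, hE, hE, lie_ιE_ιE, map_zero])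
        rwa [leibniz_lie, hhE, hhE, lie_zero] at hz)
      lie_lie_E_f_E := fun a b => by
        rw [congr_left (x' := σ (ιH k a)) _ (by rw [hH, hσ])]
        change ⁅σ (ιH k a), ⁅h, σ (ιE k b)⁆⁆ = ⁅h, σ (ιE k (a * b))⁆
        -- The commutator of the lifts of ½h ⊗ a and ½h ⊗ 1 is central because {a, 1} = 0.
        rw [leibniz_lie, congr_left (x' := 0), zero_lie, zero_add]
        · exact congr_right h (by rw [LieHom.map_lie, hσ, hσ, hσ, lie_ιH_ιE])
        · rw [LieHom.map_lie, hσ, hσ, lie_ιH_ιH, sym_one_right, map_zero, map_zero]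
      lie_lie_E_one_f := by
        rw [congr_left (x' := h) f (by rw [hH, hσ]), hhf]
      lie_f_f := fun a => eq_zero (by
        have hz := congr_right (y := ⁅⁅⁅E a, f⁆, f⁆, f⁆) (y' := 0) h (by
          rw [LieHom.map_lie, hF, hf, neg_lie, lie_ιF_ιF, map_zero, neg_zero])
        rw [leibniz_lie, hhf, lie_zero, congr_left (x' := -⁅⁅E a, f⁆, f⁆), neg_lie, lie_neg] at hz
        · rw [← neg_eq_zero, ← hz, neg_add]
        · rw [LieHom.map_lie, map_neg, hF, hσ, lie_neg, lie_ιH_one]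
          simp) }
  refine ⟨C.toLieHom, eq_on (fun a => ?_) ?_⟩
  · rw [LieHom.comp_apply, C.toLieHom_ιE, hE, LieHom.id_apply]
  · rw [LieHom.comp_apply, C.toLieHom_ιF_one, hf, LieHom.id_apply]

/-- The second homology of the Tits–Allison–Gao algebra vanishes. -/
lemma subsingleton_lieH₂ : Subsingleton (LieH₂ k (TitsAllisonGao k J)) := by
  let W := TrivialLieModule k (TitsAllisonGao k J) (WedgeModBoundaries k (TitsAllisonGao k J))
  let eW : W ≃ₗ[k] WedgeModBoundaries k (TitsAllisonGao k J) := TrivialLieModule.equiv _ _ _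
  let c : twoCocycle k (TitsAllisonGao k J) W :=
    ⟨⟨(WedgeModBoundaries.wedge k (TitsAllisonGao k J)).compr₂ eW.symm.toLinearMap,
      fun x => by simp [WedgeModBoundaries.wedge_self]⟩, by
      ext x y z
      simp only [d₂₃_apply, trivial_lie_zero, sub_self, add_zero, zero_sub]
      exact congrArg eW.symm (WedgeModBoundaries.wedge_cocycle k _ x y z)⟩
  -- The central extension defined by the universal cocycle splits, and the second component of a
  -- section bounds that cocycle.
  let p : LieAlgebra.ofTwoCocycle c →ₗ⁅k⁆ TitsAllisonGao k J :=
    { toFun := fun x => x.carrier.1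
      map_add' := fun _ _ => rfl
      map_smul' := fun _ _ => rfl
      map_lie' := rfl }
  have hc (x y : LieAlgebra.ofTwoCocycle c) : ⁅x, y⁆.carrier.2 =
      WedgeModBoundaries.wedge k _ x.carrier.1 y.carrier.1 := by
    rw [LieAlgebra.bracket_ofTwoCocycle]
    refine Eq.trans (b := (c : TitsAllisonGao k J →ₗ[k] _ →ₗ[k] W) x.carrier.1 y.carrier.1 + _ - _)
      rfl ?_
    rw [trivial_lie_zero, trivial_lie_zero, add_zero, sub_zero]
    rfl
  obtain ⟨s, hs⟩ := exists_section_of_central p (fun x => ⟨⟨(x, 0)⟩, rfl⟩) (fun x hx y => by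
    have h1 : ⁅x, y⁆.carrier.1 = 0 := by
      change p ⁅x, y⁆ = 0
      rw [LieHom.map_lie, hx, zero_lie]
    have h2 : ⁅x, y⁆.carrier.2 = 0 := by
      rw [hc, show x.carrier.1 = 0 from hx, map_zero]
      rfl
    calc ⁅x, y⁆ = ⟨(⁅x, y⁆.carrier.1, ⁅x, y⁆.carrier.2)⟩ := rfl
      _ = 0 := by rw [h1, h2]; rfl)
  have hs (x) : (s x).carrier.1 = x := LieHom.congr_fun hs x
  refine WedgeModBoundaries.subsingleton_lieH₂_of_coboundary
    { toFun := fun x => eW (s x).carrier.2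
      map_add' := fun x y => by rw [map_add]; rfl
      map_smul' := fun a x => by rw [map_smul]; rfl } (fun x y => ?_)
  change eW (s ⁅x, y⁆).carrier.2 = _
  rw [LieHom.map_lie, hc, hs, hs]
  rfl

end TitsAllisonGao

/-! ### The grading of the Tits–Allison–Gao algebra -/

section Grading

variable {k : Type u} [Field k] {L : Type v} [LieRing L] [LieAlgebra k L]

lemma mem_lieGradedPiece {h x : L} {i : ℤ} : x ∈ lieGradedPiece k h i ↔ ⁅h, x⁆ = (2 * i) • x :=
  Iff.rfl

lemma lie_mem_lieGradedPiece {h x y : L} {i j l : ℤ} (hx : x ∈ lieGradedPiece k h i)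
    (hy : y ∈ lieGradedPiece k h j) (hl : i + j = l) : ⁅x, y⁆ ∈ lieGradedPiece k h l := by
  rw [mem_lieGradedPiece] at *
  rw [leibniz_lie, hx, hy, zsmul_lie, lie_zsmul, ← add_smul, ← hl, mul_add]

variable (k) in
lemma iSupIndep_lieGradedPiece [NeZero (2 : k)] (h : L) :
    iSupIndep fun i : SignType => lieGradedPiece k h (i : ℤ) := by
  have key (i : SignType) : lieGradedPiece k h (i : ℤ) =
      Module.End.eigenspace (LieAlgebra.ad k L h) ((2 * (i : ℤ) : ℤ) : k) := by
    ext x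
    rw [Module.End.mem_eigenspace_iff, mem_lieGradedPiece, LieAlgebra.ad_apply,
      Int.cast_smul_eq_zsmul]
  simp only [key]
  have h2 : (2 : k) ≠ 0 := NeZero.ne 2
  refine (Module.End.eigenspaces_iSupIndep (LieAlgebra.ad k L h)).comp ?_
  intro i j hij
  have h4 : (4 : k) ≠ 0 := by rw [show (4 : k) = 2 * 2 by norm_num]; exact mul_ne_zero h2 h2
  cases i <;> cases j <;>
    simp [h2, h2.symm, eq_neg_iff_add_eq_zero, neg_eq_iff_add_eq_zero,
      show (2 : k) + 2 = 4 by norm_num, h4] at hij ⊢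

end Grading

namespace TitsAllisonGao

open UniversalInner

variable (k : Type u) [Field k] (J : Type v) [NonAssocCommRing J] [Module k J]
  [IsScalarTower k J J] [SMulCommClass k J J] [NeZero (2 : k)] [IsCommJordan J]

lemma mem_lieGradedPiece_iff {x : TitsAllisonGao k J} {i : ℤ} :
    x ∈ lieGradedPiece k ((2 : k) • ιH k (1 : J)) i ↔ ιE k x.e - ιF k x.f = i • x := by
  rw [mem_lieGradedPiece, smul_lie, lie_ιH_one, mul_smul, ← Int.cast_smul_eq_zsmul k 2,
    Int.cast_ofNat]
  exact smul_right_inj (NeZero.ne 2)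

lemma ιE_mem (a : J) : ιE k a ∈ lieGradedPiece k ((2 : k) • ιH k (1 : J)) 1 := by
  rw [mem_lieGradedPiece_iff]; simp

lemma ιF_mem (a : J) : ιF k a ∈ lieGradedPiece k ((2 : k) • ιH k (1 : J)) (-1) := by
  rw [mem_lieGradedPiece_iff]; simp

lemma ιH_mem (a : J) : ιH k a ∈ lieGradedPiece k ((2 : k) • ιH k (1 : J)) 0 := by
  rw [mem_lieGradedPiece_iff]; simp

lemma ιInner_mem (x : UniversalInner k J) :
    ιInner x ∈ lieGradedPiece k ((2 : k) • ιH k (1 : J)) 0 := by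
  rw [mem_lieGradedPiece_iff]; simp

variable {k J} in
lemma eq_ιE_of_mem {x : TitsAllisonGao k J}
    (hx : x ∈ lieGradedPiece k ((2 : k) • ιH k (1 : J)) 1) : x = ιE k x.e := by
  rw [mem_lieGradedPiece_iff, one_smul] at hx
  have hf : x.f = 0 := by
    have h : 0 - x.f = x.f := by simpa using congrArg TitsAllisonGao.f hx
    refine (smul_eq_zero.1 ?_).resolve_left (NeZero.ne (2 : k))
    rw [two_smul]
    nth_rw 1 [← h, zero_sub, neg_add_cancel]
  rw [hf, map_zero, sub_zero] at hx
  exact hx.symm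

/-- The Tits–Allison–Gao algebra as an `A₁`-graded Lie algebra. -/
def a1Graded : A1GradedLieAlg.{u, v} k where
  carrier := TitsAllisonGao k J
  h := (2 : k) • ιH k 1
  e := (2 : k) • ιE k 1
  f := ιF k 1
  lie_e_f := by rw [smul_lie, lie_ιE_ιF_one]
  lie_h_e := by
    rw [smul_lie, lie_smul, lie_ιH_ιE, one_mul, ← Int.cast_smul_eq_zsmul k, Int.cast_ofNat]
  lie_h_f := by
    rw [smul_lie, lie_ιH_ιF_one, ← Int.cast_smul_eq_zsmul k]
    simp
  isInternal := by
    refine DirectSum.isInternal_submodule_of_iSupIndep_of_iSup_eq_top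
      (iSupIndep_lieGradedPiece k _) (eq_top_iff.2 fun x _ => ?_)
    have hle (i : SignType) := le_iSup (fun i : SignType => lieGradedPiece k
      ((2 : k) • ιH k (1 : J)) (i : ℤ)) i
    rw [eq_sum x]
    exact add_mem (add_mem (add_mem (hle 1 (ιE_mem k J _)) (hle 0 (ιH_mem k J _)))
      (hle (-1) (ιF_mem k J _))) (hle 0 (ιInner_mem k J _))
  zero_eq_lie := by
    set S := Submodule.span k {z | ∃ x ∈ lieGradedPiece k ((2 : k) • ιH k (1 : J)) (-1),
      ∃ y ∈ lieGradedPiece k ((2 : k) • ιH k (1 : J)) 1, ⁅x, y⁆ = z}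
    have hS (a b : J) : ⁅ιE k a, ιF k b⁆ ∈ S := by
      rw [← lie_skew]
      exact neg_mem (Submodule.subset_span ⟨_, ιF_mem k J b, _, ιE_mem k J a, rfl⟩)
    have hH (a : J) : ιH k a ∈ S := lie_ιE_ιF_one k J a ▸ hS a 1
    have hI (x : UniversalInner k J) : ιInner x ∈ S := by
      induction x using UniversalInner.induction with
      | zero => rw [map_zero]; exact zero_mem _
      | sym a b =>
        have := sub_mem (hS a b) (hH (a * b))
        rwa [lie_ιE_ιF, add_sub_cancel_left] at this
      | add x y hx hy => rw [map_add]; exact add_mem hx hy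
    apply le_antisymm
    · intro x hx
      rw [mem_lieGradedPiece_iff, zero_smul] at hx
      have he : x.e = 0 := by simpa using congrArg TitsAllisonGao.e hx
      have hf : x.f = 0 := by simpa using congrArg TitsAllisonGao.f hx
      rw [eq_sum x, he, hf, map_zero, map_zero, zero_add, add_zero]
      exact add_mem (hH _) (hI _)
    · rw [Submodule.span_le]
      rintro _ ⟨x, hx, y, hy, rfl⟩
      exact lie_mem_lieGradedPiece hx hy (by norm_num)

end TitsAllisonGao

/-! ### The Jordan algebra L₁ and the canonical map onto L -/

namespace A1GradedLieAlg

variable {k : Type u} [Field k] (L : A1GradedLieAlg.{u, v} k)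

lemma e_mem : L.e ∈ lieGradedPiece k L.h 1 := L.lie_h_e

lemma f_mem : L.f ∈ lieGradedPiece k L.h (-1) := L.lie_h_f

@[elab_as_elim]
lemma graded_induction {p : L → Prop} (x : L) (neg_one : ∀ x ∈ lieGradedPiece k L.h (-1), p x)
    (zero : ∀ x ∈ lieGradedPiece k L.h 0, p x) (one : ∀ x ∈ lieGradedPiece k L.h 1, p x)
    (add : ∀ x y, p x → p y → p (x + y)) : p x := by
  have hx : x ∈ ⨆ i : SignType, lieGradedPiece k L.h (i : ℤ) := by
    rw [L.isInternal.submodule_iSup_eq_top]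
    trivial
  induction hx using Submodule.iSup_induction' with
  | mem i x hx =>
    cases i with
    | zero => exact zero x hx
    | neg => exact neg_one x hx
    | pos => exact one x hx
  | zero => exact zero 0 (zero_mem _)
  | add x y _ _ hx hy => exact add x y hx hy

/-- The eigenvalues of ad h are 0 and ±2, the roots of X³ - 4X. -/
lemma lie_h_lie_h_lie_h (x : L) : ⁅L.h, ⁅L.h, ⁅L.h, x⁆⁆⁆ = (4 : ℤ) • ⁅L.h, x⁆ := by
  induction x using L.graded_induction with
  | neg_one x hx =>
    rw [mem_lieGradedPiece] at hx
    simp only [hx, lie_zsmul, ← mul_smul]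
    norm_num
  | zero x hx =>
    rw [mem_lieGradedPiece] at hx
    simp only [hx, lie_zsmul, ← mul_smul]
    norm_num
  | one x hx =>
    rw [mem_lieGradedPiece] at hx
    simp only [hx, lie_zsmul, ← mul_smul]
    norm_num
  | add x y hx hy => simp only [lie_add, hx, hy, smul_add]

/-- Here ad h acts by ±4, where X³ - 4X takes the value ±48 = ±2⁴·3. In characteristic 3 the
eigenvalues 4 and -2 would coincide. -/
lemma eq_zero_of_mem [NeZero (2 : k)] [NeZero (3 : k)] {i : ℤ} (hi : i = 2 ∨ i = -2)
    {x : L} (hx : x ∈ lieGradedPiece k L.h i) :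
    x = 0 := by
  rw [mem_lieGradedPiece] at hx
  have h := L.lie_h_lie_h_lie_h x
  simp only [hx, lie_zsmul, ← mul_smul] at h
  rw [← sub_eq_zero, ← sub_smul, ← Int.cast_smul_eq_zsmul k] at h
  refine (smul_eq_zero.1 h).resolve_left ?_
  have h2 : (2 : k) ≠ 0 := NeZero.ne 2
  have h3 : (3 : k) ≠ 0 := NeZero.ne 3
  have h48 : (48 : k) ≠ 0 := by
    rw [show (48 : k) = 2 * 2 * 2 * 2 * 3 by norm_num]
    simp [h2, h3]
  rcases hi with rfl | rfl
  · norm_num [h48]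
  · norm_num [h48]

/-- The component `L₁`, on which the Jordan product lives. -/
def JordanPart : Type v := L.one

namespace JordanPart

instance : AddCommGroup L.JordanPart := inferInstanceAs (AddCommGroup L.one)
instance : Module k L.JordanPart := inferInstanceAs (Module k L.one)

/-- The inclusion of `L₁` in `L`. -/
def incl : L.JordanPart →ₗ[k] L := L.one.subtype

lemma incl_injective : Function.Injective (incl L) := Subtype.val_injective

lemma range_incl : LinearMap.range (incl L) = L.one := Submodule.range_subtype _

lemma incl_mem (a : L.JordanPart) : incl L a ∈ lieGradedPiece k L.h 1 := a.2

variable {L}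

/-- An element of degree one as an element of `L₁`. -/
def mk (x : L) (hx : x ∈ lieGradedPiece k L.h 1) : L.JordanPart := ⟨x, hx⟩

lemma lie_lie_incl_f_mem (a b : L.JordanPart) :
    ⁅⁅incl L a, L.f⁆, incl L b⁆ ∈ lieGradedPiece k L.h 1 :=
  lie_mem_lieGradedPiece (lie_mem_lieGradedPiece a.2 L.f_mem (add_neg_cancel 1)) b.2 (zero_add 1)

instance : Mul L.JordanPart := ⟨fun a b => mk _ (lie_lie_incl_f_mem a b)⟩
instance : One L.JordanPart := ⟨mk ((2 : k)⁻¹ • L.e) (Submodule.smul_mem _ _ L.e_mem)⟩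

lemma incl_mul (a b : L.JordanPart) : incl L (a * b) = ⁅⁅incl L a, L.f⁆, incl L b⁆ := rfl

lemma incl_one : incl L 1 = (2 : k)⁻¹ • L.e := rfl

lemma lie_incl_one_f : ⁅incl L 1, L.f⁆ = (2 : k)⁻¹ • L.h := by
  rw [incl_one, smul_lie, L.lie_e_f]

protected lemma one_mul [NeZero (2 : k)] (a : L.JordanPart) : 1 * a = a := by
  apply incl_injective
  rw [incl_mul, lie_incl_one_f, smul_lie, show ⁅L.h, incl L a⁆ = _ from a.2, mul_one,
    ← Int.cast_smul_eq_zsmul k, smul_smul, Int.cast_ofNat, inv_mul_cancel₀ (NeZero.ne 2), one_smul]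
  rfl

variable [NeZero (2 : k)] [NeZero (3 : k)]

lemma lie_incl_incl (a b : L.JordanPart) : ⁅incl L a, incl L b⁆ = 0 :=
  L.eq_zero_of_mem (Or.inl rfl) (lie_mem_lieGradedPiece a.2 b.2 (by norm_num))

/-- Jacobi, together with [L₁, L₁] = 0. -/
protected lemma mul_comm (a b : L.JordanPart) : a * b = b * a := by
  apply incl_injective
  rw [incl_mul, incl_mul, lie_lie, lie_incl_incl, lie_zero, sub_zero, ← lie_skew L.f, lie_neg,
    lie_skew]

instance : NonAssocCommRing L.JordanPart :=
  { (inferInstance : AddCommGroup L.JordanPart) with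
    mul_comm := JordanPart.mul_comm
    one_mul := JordanPart.one_mul
    mul_one := fun a => by rw [JordanPart.mul_comm, JordanPart.one_mul]
    zero_mul := fun a => incl_injective L (by rw [incl_mul, map_zero, zero_lie, zero_lie])
    mul_zero := fun a => incl_injective L (by rw [incl_mul, map_zero, lie_zero])
    left_distrib := fun a b c => incl_injective L (by simp [incl_mul])
    right_distrib := fun a b c => incl_injective L (by simp [incl_mul]) }

instance : IsScalarTower k L.JordanPart L.JordanPart where
  smul_assoc c a b := incl_injective L (by simp [incl_mul])

instance : SMulCommClass k L.JordanPart L.JordanPart where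
  smul_comm c a b := incl_injective L (by simp [incl_mul])

variable (L) in
lemma isCoordinatization : IsCoordinatization (incl L) L.f where
  lie_E_E := lie_incl_incl
  lie_lie_E_f_E a b := (incl_mul a b).symm
  lie_lie_E_one_f := by
    rw [lie_incl_one_f, smul_lie, L.lie_h_f, ← Int.cast_smul_eq_zsmul k, smul_smul]
    simp [inv_mul_cancel₀ (NeZero.ne (2 : k))]
  lie_f_f a := L.eq_zero_of_mem (Or.inr rfl) (lie_mem_lieGradedPiece (lie_mem_lieGradedPiece
    (lie_mem_lieGradedPiece a.2 L.f_mem (add_neg_cancel 1)) L.f_mem rfl) L.f_mem rfl)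

instance : IsCommJordan L.JordanPart where
  lmul_comm_rmul_rmul := (isCoordinatization L).jordan (incl_injective L)

end JordanPart

open JordanPart UniversalInner

variable [NeZero (2 : k)] [NeZero (3 : k)]

/-- The canonical map to `L` from the Tits–Allison–Gao algebra of `L₁`. -/
def counit : TitsAllisonGao k L.JordanPart →ₗ⁅k⁆ L := (isCoordinatization L).toLieHom

lemma counit_surjective : Function.Surjective L.counit := by
  rw [← LieHom.coe_toLinearMap, ← LinearMap.range_eq_top, eq_top_iff]
  have hpos (y) (hy : y ∈ lieGradedPiece k L.h 1) : y ∈ L.counit.range :=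
    ⟨TitsAllisonGao.ιE k (JordanPart.mk y hy), by
      exact (isCoordinatization L).toLieHom_ιE _⟩
  have hneg (y) (hy : y ∈ lieGradedPiece k L.h (-1)) : y ∈ L.counit.range := by
    have hf : L.f ∈ L.counit.range :=
      ⟨TitsAllisonGao.ιF k 1, (isCoordinatization L).toLieHom_ιF_one⟩
    have hyf : ⁅y, L.f⁆ = 0 := L.eq_zero_of_mem (Or.inr rfl) (lie_mem_lieGradedPiece hy L.f_mem rfl)
    have hey : ⁅L.e, y⁆ ∈ lieGradedPiece k L.h 0 := lie_mem_lieGradedPiece L.e_mem hy rfl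
    have heyf : ⁅⁅L.e, y⁆, L.f⁆ = (-2 : ℤ) • y := by
      rw [lie_lie, hyf, lie_zero, L.lie_e_f, zero_sub, lie_skew]
      exact hy
    -- On L₋₁ the operator (ad f)²(ad e)² is 4, so y is recovered from [e, [e, y]] in L₁ and f.
    have ha : ⁅⁅⁅L.e, ⁅L.e, y⁆⁆, L.f⁆, L.f⁆ = (4 : ℤ) • y := by
      rw [lie_lie L.e, L.lie_e_f, ← lie_skew _ L.h, show ⁅L.h, ⁅L.e, y⁆⁆ = _ from hey, heyf,
        mul_zero, zero_smul, neg_zero, sub_zero, lie_zsmul, zsmul_lie, heyf, ← mul_smul]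
      rfl
    have h4 : (4 : k) ≠ 0 := by
      rw [show (4 : k) = 2 * 2 by norm_num]
      exact mul_ne_zero (NeZero.ne 2) (NeZero.ne 2)
    have hmem := L.counit.range.lie_mem (L.counit.range.lie_mem
      (hpos _ (lie_mem_lieGradedPiece L.e_mem hey rfl)) hf) hf
    rw [ha, ← Int.cast_smul_eq_zsmul k, Int.cast_ofNat] at hmem
    rw [← inv_smul_smul₀ h4 y]
    exact L.counit.range.smul_mem _ hmem
  rintro x -
  change x ∈ L.counit.range
  induction x using L.graded_induction with
  | neg_one x hx => exact hneg x hx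
  | one x hx => exact hpos x hx
  | add x y hx hy => exact add_mem hx hy
  | zero x hx =>
    rw [L.zero_eq_lie] at hx
    induction hx using Submodule.span_induction with
    | mem x hx =>
      obtain ⟨y, hy, z, hz, rfl⟩ := hx
      exact L.counit.range.lie_mem (hneg y hy) (hpos z hz)
    | zero => exact zero_mem _
    | add x y _ _ hx hy => exact add_mem hx hy
    | smul c x _ hx => exact L.counit.range.smul_mem c hx

/-- The kernel of the canonical map consists of inner symbols that act trivially on `L₁`. -/
lemma of_counit_eq_zero {x : TitsAllisonGao k L.JordanPart} (hx : L.counit x = 0) :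
    x = TitsAllisonGao.ιInner x.inner ∧ der x.inner = 0 := by
  -- The kernel is an ideal and meets ½e ⊗ J trivially, so it suffices to move each coordinate of x
  -- into that slot by brackets.
  have hlie {x} (y : TitsAllisonGao k L.JordanPart) (h : L.counit x = 0) : L.counit ⁅y, x⁆ = 0 := by
    rw [LieHom.map_lie, h, lie_zero]
  have hE {a : L.JordanPart} (h : L.counit (TitsAllisonGao.ιE k a) = 0) : a = 0 :=
    incl_injective L (by rwa [map_zero, ← (isCoordinatization L).toLieHom_ιE])
  have hE' {y : TitsAllisonGao k L.JordanPart} (h : L.counit y = 0) (h' : y = .ιE k y.e) :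
      y.e = 0 := hE (h' ▸ h)
  have h1 : x.e = 0 := by
    refine (smul_eq_zero.1 (hE' (y := (2 : k) • TitsAllisonGao.ιE k x.e) ?_ ?_)).resolve_left
      (NeZero.ne 2)
    -- For D = ad (½h ⊗ 1), the operator D + D² is 2 on the e-coordinate and 0 on the others.
    · have h1 := hlie (TitsAllisonGao.ιH k 1) hx
      have h2 := hlie (TitsAllisonGao.ιH k 1) h1
      rw [TitsAllisonGao.lie_ιH_one x] at h1 h2
      rw [TitsAllisonGao.lie_ιH_one] at h2
      rw [← add_zero (0 : L)]
      nth_rw 1 [← h1]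
      rw [← h2, ← map_add]
      congr 1
      ext <;> simp [two_smul]
    · ext <;> simp
  have h2 : x.f = 0 := by
    have h := hlie (TitsAllisonGao.ιE k 1) (hlie (TitsAllisonGao.ιE k 1) (hlie (.ιH k 1) hx))
    have := hE' h (by ext <;> simp [h1, sym_one_left])
    simpa [h1] using this
  have h3 : x.h = 0 := by
    have := hE' (hlie (TitsAllisonGao.ιE k 1) hx) (by ext <;> simp [h1, h2])
    simpa [h1, h2] using this
  constructor
  · ext <;> simp [h1, h2, h3]
  · ext a
    have := hE' (hlie (TitsAllisonGao.ιE k a) hx) (by ext <;> simp [h1, h2, h3])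
    simpa [h1, h2, h3] using this

lemma counit_central {x : TitsAllisonGao k L.JordanPart} (hx : L.counit x = 0)
    (y : TitsAllisonGao k L.JordanPart) : ⁅x, y⁆ = 0 := by
  obtain ⟨h1, h2⟩ := L.of_counit_eq_zero hx
  rw [h1]
  ext <;> simp [h2, bracket_eq_zero_of_der_eq_zero h2]

open scoped TensorProduct in
-- Since the kernel is central, (x, y) ↦ [σ x, σ y] is a cocycle on L for any linear section σ,
-- giving φ on ⋀²L modulo boundaries. A kernel element Σ{a, b} is φ of Θ t = Σ H a ∧ H b, whose
-- bracket in L is the image of that element, namely 0; so H₂(L) = 0 forces Θ t = 0.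
lemma counit_injective (hL : Subsingleton (LieH₂ k L)) : Function.Injective L.counit := by
  obtain ⟨σ, hσ⟩ :=
    (L.counit : TitsAllisonGao k L.JordanPart →ₗ[k] L).exists_rightInverse_of_surjective
    (LinearMap.range_eq_top.2 L.counit_surjective)
  have hσ (x) : L.counit (σ x) = x := LinearMap.congr_fun hσ x
  have congr_left {x x'} (y : TitsAllisonGao k L.JordanPart) (h : L.counit x = L.counit x') :
      ⁅x, y⁆ = ⁅x', y⁆ := by
    rw [← sub_eq_zero, ← sub_lie]
    exact L.counit_central (by rw [map_sub, h, sub_self]) y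
  have hlie (x y : L) (z) : ⁅σ ⁅x, y⁆, z⁆ = ⁅⁅σ x, σ y⁆, z⁆ :=
    congr_left z (by rw [hσ, LieHom.map_lie, hσ, hσ])
  let φ : WedgeModBoundaries k L →ₗ[k] TitsAllisonGao k L.JordanPart :=
    WedgeModBoundaries.lift
      ((LieModule.toEnd k (TitsAllisonGao k L.JordanPart) (TitsAllisonGao k L.JordanPart) :
        _ →ₗ[k] Module.End k _).compl₁₂ σ σ)
      (fun x => by simp) (fun x y z => by
        simp only [LinearMap.compl₁₂_apply, LieHom.coe_toLinearMap, LieModule.toEnd_apply_apply,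
          hlie]
        rw [lie_skew, ← lie_skew (σ x) (σ z), neg_lie, lie_skew, sub_eq_add_neg, lie_skew,
          ← lie_jacobi (σ x) (σ y) (σ z)]
        abel)
  have hφ (x y : L) : φ (WedgeModBoundaries.wedge k L x y) = ⁅σ x, σ y⁆ :=
    WedgeModBoundaries.lift_wedge _ _ _ _ _
  let H : L.JordanPart →ₗ[k] L :=
    (L.counit : TitsAllisonGao k L.JordanPart →ₗ[k] L) ∘ₗ TitsAllisonGao.ιH k
  let Θ : L.JordanPart ⊗[k] L.JordanPart →ₗ[k] WedgeModBoundaries k L :=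
    TensorProduct.lift ((WedgeModBoundaries.wedge k L).compl₁₂ H H)
  have hΘ : WedgeModBoundaries.bracket k L ∘ₗ Θ =
      (L.counit : TitsAllisonGao k L.JordanPart →ₗ[k] L) ∘ₗ
        TitsAllisonGao.ιInner ∘ₗ UniversalInner.proj k := by
    refine TensorProduct.ext' fun a b => ?_
    simp [Θ, H, ← sym_apply, ← TitsAllisonGao.lie_ιH_ιH]
  have hφΘ : φ ∘ₗ Θ = TitsAllisonGao.ιInner ∘ₗ UniversalInner.proj k := by
    refine TensorProduct.ext' fun a b => ?_
    simp only [Θ, H, LinearMap.comp_apply, TensorProduct.lift.tmul, LinearMap.compl₁₂_apply, hφ,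
      ← sym_apply, ← TitsAllisonGao.lie_ιH_ιH, LieHom.coe_toLinearMap]
    rw [congr_left _ (hσ _), ← lie_skew, congr_left _ (hσ _), lie_skew]
  rw [injective_iff_map_eq_zero]
  intro x hx
  obtain ⟨t, ht⟩ := UniversalInner.proj_surjective k x.inner
  have h := (L.of_counit_eq_zero hx).1
  have h0 : Θ t = 0 := (WedgeModBoundaries.subsingleton_lieH₂_iff k L).1 hL (by
    rw [map_zero, ← LinearMap.comp_apply, hΘ, LinearMap.comp_apply, LinearMap.comp_apply, ht, ← h]
    exact hx)
  rw [h, ← ht, ← LinearMap.comp_apply, ← hφΘ, LinearMap.comp_apply, h0, map_zero]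

end A1GradedLieAlg

/-! ### The functor L ↦ L₁ is faithful, and full where H₂ vanishes -/

namespace A1GradedLieAlg

open JordanPart

variable {k : Type u} [Field k]

lemma Hom.map_mem_one {L K : A1GradedLieAlg.{u, v} k} (φ : L ⟶ K) {x : L}
    (hx : x ∈ lieGradedPiece k L.h 1) : φ.toLieHom x ∈ lieGradedPiece k K.h 1 := by
  rw [mem_lieGradedPiece] at *
  rw [← φ.map_h, ← LieHom.map_lie, hx, map_zsmul]

lemma two_smul_incl_one [NeZero (2 : k)] (L : A1GradedLieAlg.{u, v} k) : (2 : k) • incl L 1 = L.e := by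
  rw [incl_one, smul_inv_smul₀ (NeZero.ne 2)]

variable [NeZero (2 : k)] [NeZero (3 : k)]

variable (k) in
/-- The functor `L ↦ L₁` from `A₁`-graded Lie algebras to unital Jordan algebras. -/
def jordanFunctor : A1GradedLieAlg.{u, v} k ⥤ UnitalJordanAlg.{u, v} k where
  obj L := { carrier := L.JordanPart }
  map {L K} φ :=
    { toLin := (φ.toLieHom : L →ₗ[k] K).restrict (fun _ hx => φ.map_mem_one hx)
      map_mul := fun a b => incl_injective K (by
        change φ.toLieHom ⁅⁅incl L a, L.f⁆, incl L b⁆ =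
          ⁅⁅φ.toLieHom (incl L a), K.f⁆, φ.toLieHom (incl L b)⁆
        rw [LieHom.map_lie, LieHom.map_lie, φ.map_f])
      map_one := incl_injective K (by
        change φ.toLieHom ((2 : k)⁻¹ • L.e) = (2 : k)⁻¹ • K.e
        rw [map_smul, φ.map_e]) }

lemma incl_jordanFunctor_map {L K : A1GradedLieAlg.{u, v} k} (φ : L ⟶ K) (a : L.JordanPart) :
    incl K (((jordanFunctor k).map φ).toLin a) = φ.toLieHom (incl L a) := rfl

/-- An `A₁`-graded Lie algebra is generated by `L₁` and `f`. -/
lemma hom_ext {L : A1GradedLieAlg.{u, v} k} {K : Type*} [LieRing K] [LieAlgebra k K]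
    {φ ψ : L →ₗ⁅k⁆ K} (h : ∀ a : L.JordanPart, φ (incl L a) = ψ (incl L a))
    (hf : φ L.f = ψ L.f) : φ = ψ := by
  have : φ.comp L.counit = ψ.comp L.counit := by
    refine TitsAllisonGao.eq_on (fun a => ?_) ?_
    · rw [LieHom.comp_apply, LieHom.comp_apply, counit, IsCoordinatization.toLieHom_ιE, h]
    · rw [LieHom.comp_apply, LieHom.comp_apply, counit, IsCoordinatization.toLieHom_ιF_one, hf]
  ext x
  obtain ⟨y, rfl⟩ := L.counit_surjective x
  exact LieHom.congr_fun this y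

instance : (jordanFunctor.{u, v} k).Faithful where
  map_injective {L K φ ψ} h := by
    refine Hom.ext (hom_ext (fun a => ?_) (φ.map_f.trans ψ.map_f.symm))
    rw [← incl_jordanFunctor_map, h, incl_jordanFunctor_map]

/-- Composing with g carries the coordinatization of K by K₁ to one by L₁; only L needs vanishing
H₂, to identify it with the Tits–Allison–Gao algebra of L₁. -/
lemma exists_hom {L K : A1GradedLieAlg.{u, v} k} (hL : HasTrivialH₂ k L)
    (g : (jordanFunctor k).obj L ⟶ (jordanFunctor k).obj K) :
    ∃ φ : L ⟶ K, (jordanFunctor k).map φ = g := by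
  let g' : L.JordanPart →ₗ[k] K.JordanPart := g.toLin
  have hmul (a b : L.JordanPart) : g' (a * b) = g' a * g' b := g.map_mul a b
  have hone : g' 1 = 1 := g.map_one
  have CK := isCoordinatization K
  have C : IsCoordinatization (incl K ∘ₗ g') K.f :=
    { lie_E_E := fun a b => CK.lie_E_E _ _
      lie_lie_E_f_E := fun a b => by
        simp only [LinearMap.comp_apply, hmul]
        exact CK.lie_lie_E_f_E _ _
      lie_lie_E_one_f := by
        simp only [LinearMap.comp_apply, hone]
        exact CK.lie_lie_E_one_f
      lie_f_f := fun a => CK.lie_f_f _ }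
  let e := LieEquiv.ofBijective L.counit ⟨L.counit_injective hL, L.counit_surjective⟩
  let φ : L →ₗ⁅k⁆ K := C.toLieHom.comp e.symm.toLieHom
  have hφ (x) : φ (L.counit x) = C.toLieHom x := by
    change C.toLieHom (e.symm (e x)) = _
    rw [e.symm_apply_apply]
  have hE (a : L.JordanPart) : φ (incl L a) = incl K (g' a) := by
    have := hφ (TitsAllisonGao.ιE k a)
    rwa [counit, IsCoordinatization.toLieHom_ιE, IsCoordinatization.toLieHom_ιE] at this
  have hf : φ L.f = K.f := by
    have := hφ (TitsAllisonGao.ιF k 1)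
    rwa [counit, IsCoordinatization.toLieHom_ιF_one, IsCoordinatization.toLieHom_ιF_one] at this
  have he : φ L.e = K.e := by
    rw [← two_smul_incl_one, map_smul, hE, hone, two_smul_incl_one]
  refine ⟨⟨φ, ?_, he, hf⟩, UnitalJordanAlg.Hom.ext (LinearMap.ext fun a => ?_)⟩
  · rw [← L.lie_e_f, LieHom.map_lie, he, hf, K.lie_e_f]
  · exact incl_injective K (hE a)

end A1GradedLieAlg

/-! ### Essential surjectivity and the equivalence -/

namespace TitsAllisonGao

open A1GradedLieAlg.JordanPart

variable {k : Type u} [Field k] [NeZero (2 : k)] [NeZero (3 : k)]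

lemma hasTrivialH₂_a1Graded (J : UnitalJordanAlg.{u, v} k) : HasTrivialH₂ k (a1Graded k J) :=
  subsingleton_lieH₂

/-- The identification of a Jordan algebra with the part of degree one of its Tits–Allison–Gao
algebra. -/
def toJordanPart (J : UnitalJordanAlg.{u, v} k) :
    J ⟶ (A1GradedLieAlg.jordanFunctor k).obj (a1Graded k J) where
  toLin :=
    { toFun := fun a => A1GradedLieAlg.JordanPart.mk (L := a1Graded k J) (ιE k a) (ιE_mem k J a)
      map_add' := fun a b => incl_injective _ (map_add (ιE k) a b)
      map_smul' := fun c a => incl_injective _ (map_smul (ιE k) c a) }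
  map_mul a b := incl_injective _ ((isCoordinatization k J).lie_lie_E_f_E a b).symm
  map_one := incl_injective _ (inv_smul_smul₀ (NeZero.ne (2 : k)) (ιE k (1 : J))).symm

lemma toJordanPart_e (J : UnitalJordanAlg.{u, v} k) (a : (a1Graded k J).JordanPart) :
    (toJordanPart J).toLin (incl (a1Graded k J) a : TitsAllisonGao k J).e = a :=
  incl_injective _ (eq_ιE_of_mem (incl_mem _ a)).symm

/-- A Jordan algebra is isomorphic to the part of degree one of its Tits–Allison–Gao algebra. -/
def jordanPartIso (J : UnitalJordanAlg.{u, v} k) :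
    (A1GradedLieAlg.jordanFunctor k).obj (a1Graded k J) ≅ J where
  hom :=
    { toLin :=
        { toFun := fun x => (incl (a1Graded k J) x : TitsAllisonGao k J).e
          map_add' := fun _ _ => rfl
          map_smul' := fun _ _ => rfl }
      map_mul := fun a b => by
        change (incl (a1Graded k J) (a * b) : TitsAllisonGao k J).e = _
        conv_lhs => rw [← toJordanPart_e J a, ← toJordanPart_e J b]
        exact congrArg (fun x => (incl (a1Graded k J) x : TitsAllisonGao k J).e)
          ((toJordanPart J).map_mul _ _).symm
      map_one := congrArg (fun x => (incl (a1Graded k J) x : TitsAllisonGao k J).e)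
        (toJordanPart J).map_one.symm }
  inv := toJordanPart J
  hom_inv_id := UnitalJordanAlg.Hom.ext (LinearMap.ext (toJordanPart_e J))
  inv_hom_id := rfl

end TitsAllisonGao

/-- Over a field of characteristic different from 2 and 3, the two vanishing conditions on an
A₁-graded Lie algebra are equivalent, and the A₁-graded Lie algebras satisfying them form a
category equivalent to that of unital Jordan algebras, through `L ↦ L₁`. -/
theorem theoremC (k : Type u) [Field k] (h2 : (2 : k) ≠ 0) (h3 : (3 : k) ≠ 0) :
    (∀ L : A1GradedLieAlg.{u, v} k,
      HasTrivialH₂ k L ↔ HasTrivialCohomology₂.{u, v, w} k L) ∧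
    ∃ E : UnitalJordanAlg.{u, v} k ≌ (HasTrivialH₂.{u, v} k).FullSubcategory,
      IsJordanFunctor E.inverse := by
  have : NeZero (2 : k) := ⟨h2⟩
  have : NeZero (3 : k) := ⟨h3⟩
  refine ⟨fun L => subsingleton_lieH₂_iff_forall_lieCohomology₂, ?_⟩
  let G : (HasTrivialH₂.{u, v} k).FullSubcategory ⥤ UnitalJordanAlg.{u, v} k :=
    (HasTrivialH₂ k).ι ⋙ A1GradedLieAlg.jordanFunctor k
  have : G.Full :=
    { map_surjective := fun {L K} g => by
        obtain ⟨φ, hφ⟩ := A1GradedLieAlg.exists_hom L.property g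
        exact ⟨⟨φ⟩, hφ⟩ }
  have : G.EssSurj :=
    { mem_essImage := fun J => ⟨⟨TitsAllisonGao.a1Graded k J,
        TitsAllisonGao.hasTrivialH₂_a1Graded J⟩, ⟨TitsAllisonGao.jordanPartIso J⟩⟩ }
  -- Faithfulness of G is inferred from its two factors.
  have : G.IsEquivalence := {}
  exact ⟨G.asEquivalence.symm, fun L => A1GradedLieAlg.JordanPart.incl L.obj,
    fun L => A1GradedLieAlg.JordanPart.incl_injective L.obj,
    fun L => A1GradedLieAlg.JordanPart.range_incl L.obj,
    fun L => A1GradedLieAlg.JordanPart.incl_mul,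
    fun L => A1GradedLieAlg.two_smul_incl_one L.obj,
    fun L K φ a => A1GradedLieAlg.incl_jordanFunctor_map φ.hom a⟩
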